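/- Let $N\ge 5$, let $d\mu=\mu(x)\,dx$ be the Gaussian measure on $\mathbb R^N$ with density $\mu(x)=(2\pi)^{-N/2}e^{-|x|^2/2}$, let $C_0=\left(\frac{N-2}{2}\right)^2$, and let $H^2_\mu(\mathbb R^N)$ be the space of all $u\in L^2_\mu(\mathbb R^N)=L^2(\mathbb R^N,d\mu)$ whose weak derivatives up to order two belong to $L^2_\mu(\mathbb R^N)$ (real- or complex-valued functions). For $u\in H^2_\mu(\mathbb R^N)$ let $Lu=\Delta u-x\cdot\nabla u$ be the Ornstein–Uhlenbeck operator, and put $\|u\|^2_{H^1_\mu}=\int_{\mathbb R^N}|u|^2\,d\mu+\int_{\mathbb R^N}|\nabla u|^2\,d\mu$. For every $u\in H^2_\mu(\mathbb R^N)$ one has $Lu\in L^2_\mu(\mathbb R^N)$ and $\int_{\mathbb R^N}\frac{|u(x)|^2}{|x|^4}\,d\mu<\infty$, and there is a constant $C_1>0$, independent of $u$, such that for all $u\in H^2_\mu(\mathbb R^N)$ $$(C_0-1)^2\int_{\mathbb R^N}\frac{|u(x)|^2}{|x|^4}\,d\mu\le\int_{\mathbb R^N}|Lu(x)|^2\,d\mu+\frac{2(C_0-1)C_1}{C_0}\int_{\mathbb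 R^N}|\nabla u(x)|^2\,d\mu+\frac{2(C_0-1)C_1^2}{C_0}\int_{\mathbb R^N}|u(x)|^2\,d\mu .$$ Moreover $(C_0-1)^2=\left(\frac{N(N-4)}{4}\right)^2$ is the best constant: it is the largest $c\in\mathbb R$ for which there is $C>0$ such that $$c\int_{\mathbb R^N}\frac{|u(x)|^2}{|x|^4}\,d\mu\le\int_{\mathbb R^N}|Lu(x)|^2\,d\mu+C\|u\|^2_{H^1_\mu}\qquad\text{for all }u\in H^2_\mu(\mathbb R^N).$$ -/

import Mathlib

open MeasureTheory
open scoped ContDiff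

noncomputable section

namespace GaussianRellich

/-- The Euclidean space `ℝ^N`. -/
abbrev Space (N : ℕ) : Type := EuclideanSpace ℝ (Fin N)

/-- The Gaussian density `μ(x) = (2π)^{-N/2} e^{-|x|²/2}`. -/
def gaussianDensity (N : ℕ) (x : Space N) : ℝ :=
  (2 * Real.pi) ^ (-(N : ℝ) / 2) * Real.exp (-‖x‖ ^ 2 / 2)

/-- The Gaussian measure `dμ = μ(x) dx` on `ℝ^N`. -/
def gaussianMeasure (N : ℕ) : Measure (Space N) :=
  volume.withDensity fun x => ENNReal.ofReal (gaussianDensity N x)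

variable {𝕜 : Type*} [RCLike 𝕜] {N : ℕ}

/-- `v` is the weak (distributional) partial derivative `D_i u` on `ℝ^N`:
`∫ u D_i φ dx = - ∫ v φ dx` for every real test function `φ ∈ C_c^∞(ℝ^N)`. -/
def HasWeakPartial (i : Fin N) (u v : Space N → 𝕜) : Prop :=
  LocallyIntegrable u ∧ LocallyIntegrable v ∧
    ∀ φ : Space N → ℝ, ContDiff ℝ ∞ φ → HasCompactSupport φ →
      ∫ x, fderiv ℝ φ x (EuclideanSpace.single i 1) • u x = -∫ x, φ x • v x

open Classical in
/-- The weak partial derivative `D_i u` (unique up to null sets), a chosen representative of it;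
it is `0` if `u` has no weak partial derivative in direction `i`. -/
def weakPartial (i : Fin N) (u : Space N → 𝕜) : Space N → 𝕜 :=
  if h : ∃ v, HasWeakPartial i u v then h.choose else 0

/-- `u` belongs to the weighted Sobolev space `H²_μ(ℝ^N)`: `u`, its weak first derivatives and its
weak second derivatives exist and lie in `L²_μ(ℝ^N)`. -/
structure MemH2 (u : Space N → 𝕜) : Prop where
  memLp : MemLp u 2 (gaussianMeasure N)
  hasWeakPartial : ∀ i, HasWeakPartial i u (weakPartial i u)
  memLp_partial : ∀ i, MemLp (weakPartial i u) 2 (gaussianMeasure N)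
  hasWeakPartial₂ : ∀ i j, HasWeakPartial j (weakPartial i u) (weakPartial j (weakPartial i u))
  memLp_partial₂ : ∀ i j, MemLp (weakPartial j (weakPartial i u)) 2 (gaussianMeasure N)

/-- The Ornstein–Uhlenbeck operator `L u = Δ u - x · ∇ u`. -/
def ornsteinUhlenbeck (u : Space N → 𝕜) (x : Space N) : 𝕜 :=
  (∑ i, weakPartial i (weakPartial i u) x) - ∑ i, x i • weakPartial i u x

/-- `|∇ u(x)|²`. -/
def gradSq (u : Space N → 𝕜) (x : Space N) : ℝ :=
  ∑ i, ‖weakPartial i u x‖ ^ 2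

/-- The singular integral `∫ |u|² / |x|⁴ dμ`. -/
def rellichIntegral (u : Space N → 𝕜) : ℝ :=
  ∫ x, ‖u x‖ ^ 2 / ‖x‖ ^ 4 ∂(gaussianMeasure N)

/-- The squared norm `‖u‖²_{H¹_μ} = ∫ |u|² dμ + ∫ |∇ u|² dμ`. -/
def h1NormSq (u : Space N → 𝕜) : ℝ :=
  ∫ x, ‖u x‖ ^ 2 ∂(gaussianMeasure N) + ∫ x, gradSq u x ∂(gaussianMeasure N)

/-- Hardy's constant `C₀ = ((N - 2) / 2)²`. -/
def hardyConst (N : ℕ) : ℝ := (((N : ℝ) - 2) / 2) ^ 2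

end GaussianRellich

end

noncomputable section

namespace GaussianRellich

open Filter Topology Metric
open scoped Convolution

variable {N : ℕ}

/-! Write $t=(|x|^2+\varepsilon)^{-1}$, $a=(N-4)/2$ and $\kappa=C_0-1=a^2+2a$. The inequality comes
from completing squares, pointwise and before integrating: for real $u$, the sum of $(Lu+\kappa
tu)^2$, $2\kappa t\,|\nabla u+atux|^2$ and nonnegative multiples of $tu^2(1-|x|^2t)$ and
$t^2u^2(1-|x|^2t)$ equals $(Lu)^2-\kappa^2t^2u^2+2\kappa(a+1)tu^2$ plus Gaussian divergences of
$tu\nabla u$ and $t^2u^2x$, which integrate to zero (`integral_regInv_sq_le`). The remaining $\int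
tu^2\,d\mu$ is lower order: a crude Hardy inequality, proved in the same way, bounds it by the
$H^1_\mu$ norm (`integral_regInv_le`). Fatou's lemma as $\varepsilon\to0$ gives both integrability
and the inequality (`rellich_real`); real and imaginary parts are then added.

The analytic content is integration by parts for functions known only through weak derivatives. A
product of two functions of $H^1_\mu$ satisfies the Leibniz rule by mollifying one factor
(`MemGaussianH1.integral_fderiv_mul`). Testing with the field $x_i\chi_n$ shows $x_if\in L^2_\mu$
whenever $f,D_if\in L^2_\mu$ (`MemGaussianH1.memLp_coord_mul`). This puts the drift of $Lu$ in
$L^2_\mu$ and allows test functions that are merely bounded with the relevant derivative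
(`MemGaussianH1.integral_mul`).

For sharpness take $u_\varepsilon=t^\gamma$ with $\gamma=(N-4)/4$. Then $Lu_\varepsilon=-\kappa
t^{\gamma+1}$ plus an error whose square has integral bounded uniformly in $\varepsilon$, as does
$\|u_\varepsilon\|_{H^1_\mu}^2$ (`exists_uniform_bound`). But $\int t^{N/2}\,d\mu$ is unbounded,
since $|x|^{-N}$ is not integrable at the origin. A constant $c>\kappa^2$ would bound it
(`le_of_forall_rellich`). -/

theorem integrable_mul_of_memLp_two {α : Type*} [MeasurableSpace α] {ν : Measure α} {f g : α → ℝ}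
    (hf : MemLp f 2 ν) (hg : MemLp g 2 ν) : Integrable (fun x => f x * g x) ν :=
  MemLp.integrable_mul (p := 2) (q := 2) hf hg

/-! ### Weak convergence of mollifications through correlations. -/

/-- The correlation `t ↦ ∫ f(x) g(x + t) dx` of two `L²` functions is continuous. -/
theorem continuous_correlation {f g : Space N → ℝ} (hf : MemLp f 2 volume)
    (hg : MemLp g 2 volume) : Continuous fun t : Space N => ∫ x, f x * g (t + x) := by
  -- As an $L^2$ inner product with a translate of $g$, the correlation inherits the strong
  -- continuity of translations on $L^2$.
  have key : ∀ t : Space N, ∫ x, f x * g (t + x)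
      = inner ℝ (DomAddAct.mk t +ᵥ hg.toLp g) (hf.toLp f) := by
    intro t
    rw [L2.inner_def]
    refine integral_congr_ae ?_
    rw [DomAddAct.mk_vadd_toLp]
    filter_upwards [hf.coeFn_toLp, (hg.comp_measurePreserving
      (measurePreserving_vadd t (volume : Measure (Space N)))).coeFn_toLp] with x h1 h2
    have h3 : (MemLp.toLp (fun x => g (t +ᵥ x)) (hg.comp_measurePreserving
      (measurePreserving_vadd t (volume : Measure (Space N))))) x = g (t + x) := h2
    rw [h1, h3]
    simp
  simp_rw [key]
  have : Fact ((2 : ENNReal) ≠ ⊤) := ⟨by simp⟩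
  have : Continuous fun t : Space N => DomAddAct.mk t +ᵥ hg.toLp g :=
    (DomAddAct.continuous_mk).vadd continuous_const
  exact this.inner continuous_const

/-- Fubini moves the mollifier off $g$ and onto the correlation. Convergence of mollified pairings
thus reduces to continuity of one function at $0$. -/
theorem integral_mul_convolution {f g η : Space N → ℝ} (hf : MemLp f 2 volume)
    (hg : MemLp g 2 volume) (hη : Continuous η) (hc : HasCompactSupport η) :
    ∫ x, f x * (η ⋆[ContinuousLinearMap.lsmul ℝ ℝ] g) x
      = (η ⋆[ContinuousLinearMap.lsmul ℝ ℝ] fun t => ∫ x, f x * g (t + x)) 0 := by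
  have hηi : Integrable η := hη.integrable_of_hasCompactSupport hc
  have hm : AEStronglyMeasurable (fun p : Space N × Space N => f p.1 * (η p.2 * g (p.1 - p.2)))
      (volume.prod volume) := by
    refine hf.1.comp_fst.mul ?_
    exact hηi.1.convolution_integrand (ContinuousLinearMap.lsmul ℝ ℝ) hg.1
  have hint : Integrable (fun p : Space N × Space N => f p.1 * (η p.2 * g (p.1 - p.2)))
      (volume.prod volume) := by
    -- The integrand is dominated by $f(x)^2|\eta(t)|+|\eta(t)|g(x-t)^2$.
    have h1 : Integrable (fun p : Space N × Space N => f p.1 ^ 2 * |η p.2|)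
        (volume.prod volume) := hf.integrable_sq.mul_prod hηi.norm
    have h2 : Integrable (fun p : Space N × Space N => |η p.2| * g (p.1 - p.2) ^ 2)
        (volume.prod volume) :=
      hηi.norm.convolution_integrand (ContinuousLinearMap.lsmul ℝ ℝ) hg.integrable_sq
    refine (h1.add h2).mono' hm (ae_of_all _ fun p => ?_)
    have := abs_nonneg (η p.2)
    simp only [Real.norm_eq_abs, abs_mul, Pi.add_apply]
    rw [← sq_abs (f p.1), ← sq_abs (g _)]
    nlinarith [mul_nonneg this (sq_nonneg (|f p.1| - |g (p.1 - p.2)|)),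
      mul_nonneg this (sq_nonneg (|f p.1| + |g (p.1 - p.2)|))]
  simp only [convolution_def, ContinuousLinearMap.lsmul_apply, smul_eq_mul, zero_sub]
  simp_rw [← integral_const_mul]
  rw [integral_integral_swap hint]
  refine integral_congr_ae (ae_of_all _ fun t => integral_congr_ae (ae_of_all _ fun x => ?_))
  simp only [sub_eq_add_neg, add_comm x]
  ring

theorem tendsto_integral_mul_convolution {f g : Space N → ℝ} (hf : MemLp f 2 volume)
    (hg : MemLp g 2 volume) {η : ℕ → ContDiffBump (0 : Space N)}
    (hη : Tendsto (fun n => (η n).rOut) atTop (𝓝 0)) :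
    Tendsto (fun n => ∫ x, f x * ((η n).normed volume ⋆[ContinuousLinearMap.lsmul ℝ ℝ] g) x) atTop
      (𝓝 (∫ x, f x * g x)) := by
  have h := ContDiffBump.convolution_tendsto_right_of_continuous (μ := volume) hη
    (g := fun t : Space N => ∫ x, f x * g (t + x))
    (continuous_correlation hf hg) 0
  simp only [zero_add] at h
  refine h.congr fun n => ?_
  rw [integral_mul_convolution hf hg (η n).continuous_normed (η n).hasCompactSupport_normed]

/-! ### The Gaussian density, and comparison with Lebesgue measure on balls. -/

theorem gaussianDensity_pos (x : Space N) : 0 < gaussianDensity N x := by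
  unfold gaussianDensity; positivity

theorem contDiff_gaussianDensity : ContDiff ℝ ∞ (gaussianDensity N) := by
  unfold gaussianDensity
  exact contDiff_const.mul (((contDiff_norm_sq ℝ).neg.div_const 2).exp)

theorem continuous_gaussianDensity : Continuous (gaussianDensity N) :=
  contDiff_gaussianDensity.continuous

theorem fderiv_gaussianDensity (x : Space N) (i : Fin N) :
    fderiv ℝ (gaussianDensity N) x (EuclideanSpace.single i 1) = -(x i * gaussianDensity N x) := by
  have h1 : HasFDerivAt (fun x : Space N => ‖x‖ ^ 2) (2 • innerSL ℝ x) x :=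
    (hasStrictFDerivAt_norm_sq x).hasFDerivAt
  have h2 : HasFDerivAt (fun x : Space N => -‖x‖ ^ 2 / 2) (-(innerSL ℝ x)) x := by
    have := (h1.neg.mul_const (2⁻¹ : ℝ))
    convert! this using 1
    ext v; simp
  have h3 := (h2.exp).const_mul ((2 * Real.pi) ^ (-(N : ℝ) / 2))
  have h4 : HasFDerivAt (gaussianDensity N) _ x := h3
  rw [h4.fderiv]
  simp [gaussianDensity, EuclideanSpace.inner_single_right]
  ring

theorem measurable_ofReal_gaussianDensity :
    Measurable fun x : Space N => ENNReal.ofReal (gaussianDensity N x) :=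
  continuous_gaussianDensity.measurable.ennreal_ofReal

theorem gaussianMeasure_absolutelyContinuous :
    gaussianMeasure N ≪ (volume : Measure (Space N)) :=
  withDensity_absolutelyContinuous _ _

theorem integral_gaussianMeasure (f : Space N → ℝ) :
    ∫ x, f x ∂(gaussianMeasure N) = ∫ x, gaussianDensity N x * f x := by
  rw [gaussianMeasure, integral_withDensity_eq_integral_toReal_smul
    measurable_ofReal_gaussianDensity (ae_of_all _ fun x => ENNReal.ofReal_lt_top)]
  refine integral_congr_ae (ae_of_all _ fun x => ?_)
  simp [ENNReal.toReal_ofReal (gaussianDensity_pos x).le]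

instance isFiniteMeasure_gaussianMeasure : IsFiniteMeasure (gaussianMeasure N) := by
  have h : Integrable (fun x : Space N => gaussianDensity N x) := by
    have := (GaussianFourier.integrable_cexp_neg_mul_sq_norm_add (V := Space N) (b := 1 / 2)
      (by norm_num) 0 0).norm
    refine (this.const_mul ((2 * Real.pi) ^ (-(N : ℝ) / 2))).congr (ae_of_all _ fun x => ?_)
    simp only [gaussianDensity, Complex.norm_exp]
    congr 2
    simp [← Complex.ofReal_pow, Complex.mul_re]
    ring
  refine isFiniteMeasure_withDensity_ofReal h.2

/-- The density is at least its value at radius $R$ on the ball, so local questions about $L^2_\mu$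
functions can be settled in Lebesgue $L^2$. -/
theorem volume_restrict_closedBall_le (R : ℝ) : ∃ c : ENNReal, c ≠ ⊤ ∧
    (volume : Measure (Space N)).restrict (closedBall 0 R) ≤ c • gaussianMeasure N := by
  set m : ℝ := (2 * Real.pi) ^ (-(N : ℝ) / 2) * Real.exp (-R ^ 2 / 2) with hm
  have hm0 : 0 < m := by positivity
  refine ⟨(ENNReal.ofReal m)⁻¹, by simpa using hm0, ?_⟩
  have hne : ENNReal.ofReal m ≠ 0 := by simpa using hm0
  have hlow : ∀ x ∈ closedBall (0 : Space N) R,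
      ENNReal.ofReal m ≤ ENNReal.ofReal (gaussianDensity N x) := by
    intro x hx
    have : ‖x‖ ≤ R := by simpa using hx
    refine ENNReal.ofReal_le_ofReal ?_
    rw [hm, gaussianDensity]
    gcongr
  refine Measure.le_iff.2 fun A hA => ?_
  rw [Measure.restrict_apply hA, Measure.smul_apply, smul_eq_mul]
  have h1 : ENNReal.ofReal m * volume (A ∩ closedBall (0 : Space N) R) ≤ gaussianMeasure N A := by
    calc ENNReal.ofReal m * volume (A ∩ closedBall (0 : Space N) R)
        = ∫⁻ x in A ∩ closedBall (0 : Space N) R, ENNReal.ofReal m := by simp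
      _ ≤ ∫⁻ x in A ∩ closedBall (0 : Space N) R, ENNReal.ofReal (gaussianDensity N x) :=
          setLIntegral_mono measurable_ofReal_gaussianDensity fun x hx => hlow x hx.2
      _ = gaussianMeasure N (A ∩ closedBall (0 : Space N) R) := by
          rw [gaussianMeasure, withDensity_apply _ (hA.inter measurableSet_closedBall)]
      _ ≤ gaussianMeasure N A := measure_mono Set.inter_subset_left
  calc volume (A ∩ closedBall (0 : Space N) R)
      = (ENNReal.ofReal m)⁻¹ * (ENNReal.ofReal m * volume (A ∩ closedBall (0 : Space N) R)) := by
        rw [← mul_assoc, ENNReal.inv_mul_cancel hne ENNReal.ofReal_ne_top, one_mul]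
    _ ≤ _ := by gcongr

theorem memLp_restrict_closedBall {f : Space N → ℝ} (hf : MemLp f 2 (gaussianMeasure N)) (R : ℝ) :
    MemLp f 2 (volume.restrict (closedBall 0 R)) := by
  obtain ⟨c, hc, hle⟩ := volume_restrict_closedBall_le (N := N) R
  exact hf.of_measure_le_smul hc hle

theorem memLp_indicator_closedBall {f : Space N → ℝ} (hf : MemLp f 2 (gaussianMeasure N))
    (R : ℝ) : MemLp ((closedBall 0 R).indicator f) 2 volume :=
  (memLp_indicator_iff_restrict measurableSet_closedBall).2 (memLp_restrict_closedBall hf R)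

/-! ### Weak derivatives of mollifications and of products. -/

theorem tendsto_integral_mul_convolution_of_hasCompactSupport {k f g : Space N → ℝ}
    (hk : Continuous k) (hc : HasCompactSupport k) (hf : MemLp f 2 (gaussianMeasure N))
    (hg : MemLp g 2 (gaussianMeasure N)) {η : ℕ → ContDiffBump (0 : Space N)}
    (hη : Tendsto (fun n => (η n).rOut) atTop (𝓝 0)) (hη1 : ∀ n, (η n).rOut ≤ 1) :
    Tendsto (fun n => ∫ x, (k x * f x) *
      ((η n).normed volume ⋆[ContinuousLinearMap.lsmul ℝ ℝ] g) x) atTop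
      (𝓝 (∫ x, (k x * f x) * g x)) := by
  obtain ⟨R, hR⟩ := hc.isCompact.isBounded.subset_closedBall (0 : Space N)
  have hk0 : ∀ x, x ∉ closedBall (0 : Space N) R → k x = 0 := fun x hx => by
    by_contra h
    exact hx (hR (subset_tsupport _ h))
  obtain ⟨C, hC⟩ := hk.bounded_above_of_compact_support hc
  have hkf : MemLp (fun x => k x * f x) 2 volume := by
    have h1 : MemLp (fun x => k x * (closedBall 0 R).indicator f x) 2 volume := by
      refine MemLp.of_le_mul (c := C) (memLp_indicator_closedBall hf R)
        (hk.aestronglyMeasurable.mul (memLp_indicator_closedBall hf R).1) (ae_of_all _ fun x => ?_)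
      rw [norm_mul]
      gcongr
      exact hC x
    refine h1.ae_eq (ae_of_all _ fun x => ?_)
    by_cases hx : x ∈ closedBall (0 : Space N) R
    · simp [Set.indicator_of_mem hx]
    · simp [hk0 x hx]
  -- Radius $R+1$: for $x$ in the ball of radius $R$ a mollifier of radius at most $1$ only sees $g$
  -- there, so truncating $g$ changes nothing.
  have h := tendsto_integral_mul_convolution hkf (memLp_indicator_closedBall hg (R + 1)) hη
  have e : ∫ x, (k x * f x) * (closedBall (0 : Space N) (R + 1)).indicator g x
      = ∫ x, (k x * f x) * g x := by
    refine integral_congr_ae (ae_of_all _ fun x => ?_)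
    by_cases hx : x ∈ closedBall (0 : Space N) R
    · have : x ∈ closedBall (0 : Space N) (R + 1) := closedBall_subset_closedBall (by simp) hx
      simp only [Set.indicator_of_mem this]
    · simp [hk0 x hx]
  rw [e] at h
  refine h.congr fun n => integral_congr_ae (ae_of_all _ fun x => ?_)
  by_cases hx : x ∈ closedBall (0 : Space N) R
  · dsimp only
    congr 1
    simp only [convolution_def]
    refine integral_congr_ae (ae_of_all _ fun t => ?_)
    by_cases ht : t ∈ ball (0 : Space N) (η n).rOut
    · have : x - t ∈ closedBall (0 : Space N) (R + 1) := by
        have h1 : ‖x‖ ≤ R := by simpa using hx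
        have h2 : ‖t‖ < (η n).rOut := by simpa using ht
        have := norm_sub_le x t
        have := hη1 n
        simp only [mem_closedBall, dist_zero_right]
        linarith
      simp only [Set.indicator_of_mem this]
    · have : (η n).normed volume t = 0 := by
        rw [← Function.notMem_support, (η n).support_normed_eq]
        exact ht
      simp [this]
  · simp [hk0 x hx]

/-- `f` and its weak partial derivative `f' = D_i f` belong to `L²_μ`. -/
structure MemGaussianH1 (i : Fin N) (f f' : Space N → ℝ) : Prop where
  weak : HasWeakPartial i f f'
  memLp : MemLp f 2 (gaussianMeasure N)
  memLp' : MemLp f' 2 (gaussianMeasure N)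

theorem integrable_mul_of_hasCompactSupport {k f : Space N → ℝ} (hk : Continuous k)
    (hc : HasCompactSupport k) (hf : LocallyIntegrable f) : Integrable fun x => k x * f x :=
  hf.integrable_smul_left_of_hasCompactSupport hk hc

/-- The derivative falls on $\eta$, and $t\mapsto\eta(x-t)$ is an admissible test function for the
weak derivative of $g$; the two sign changes cancel. -/
theorem HasWeakPartial.fderiv_convolution {i : Fin N} {g g' : Space N → ℝ}
    (hg : HasWeakPartial i g g') {η : Space N → ℝ} (hη : ContDiff ℝ ∞ η)
    (hc : HasCompactSupport η) (x : Space N) :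
    fderiv ℝ (η ⋆[ContinuousLinearMap.lsmul ℝ ℝ] g) x (EuclideanSpace.single i 1)
      = (η ⋆[ContinuousLinearMap.lsmul ℝ ℝ] g') x := by
  have h1 := hc.hasFDerivAt_convolution_left (ContinuousLinearMap.lsmul ℝ ℝ) (μ := volume)
    (hη.of_le (by simp)) hg.1 x
  have hex := (hc.fderiv ℝ).convolutionExists_left
    ((ContinuousLinearMap.lsmul ℝ ℝ).precompL (Space N)) (μ := volume)
    (hη.continuous_fderiv (by simp)) hg.1 x
  rw [h1.fderiv, convolution_def, ContinuousLinearMap.integral_apply hex.integrable]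
  simp only [ContinuousLinearMap.precompL_apply, ContinuousLinearMap.lsmul_apply]
  rw [← integral_sub_left_eq_self _ volume x, convolution_eq_swap]
  simp only [sub_sub_cancel, ContinuousLinearMap.lsmul_apply]
  have h2 := hg.2.2 (fun t => η (x - t)) (hη.comp (contDiff_const.sub contDiff_id))
    (hc.comp_homeomorph (Homeomorph.subLeft x))
  have h3 : ∀ t, fderiv ℝ (fun t => η (x - t)) t (EuclideanSpace.single i 1)
      = -fderiv ℝ η (x - t) (EuclideanSpace.single i 1) := by
    intro t
    have := ((hη.differentiable (by simp)) (x - t)).hasFDerivAt.comp t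
      ((hasFDerivAt_id t).const_sub x)
    have h4 : HasFDerivAt (fun t => η (x - t)) _ t := this
    rw [h4.fderiv]
    simp
  simp only [h3, neg_smul, integral_neg, neg_inj] at h2
  exact h2

/-- Leibniz rule for the product of two functions of `H¹_μ`, in weak form. -/
theorem MemGaussianH1.integral_fderiv_mul {i : Fin N} {f f' g g' : Space N → ℝ}
    (hf : MemGaussianH1 i f f') (hg : MemGaussianH1 i g g') {φ : Space N → ℝ}
    (hφ : ContDiff ℝ ∞ φ) (hc : HasCompactSupport φ) :
    ∫ x, fderiv ℝ φ x (EuclideanSpace.single i 1) * (f x * g x)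
      = -∫ x, φ x * (f' x * g x + f x * g' x) := by
  let η : ℕ → ContDiffBump (0 : Space N) := fun n =>
    ⟨1 / (2 * (n + 1)), 1 / (n + 1), by positivity, by
      gcongr
      have : (0 : ℝ) < n + 1 := by positivity
      linarith⟩
  have hη : Tendsto (fun n => (η n).rOut) atTop (𝓝 0) := tendsto_one_div_add_atTop_nhds_zero_nat
  have hη1 : ∀ n, (η n).rOut ≤ 1 := fun n => by
    simp only [η]
    rw [div_le_one (by positivity)]
    simp
  set e : Space N := EuclideanSpace.single i 1
  have hφ' : Continuous fun x => fderiv ℝ φ x e :=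
    (hφ.continuous_fderiv (by simp)).clm_apply continuous_const
  have hc' : HasCompactSupport fun x => fderiv ℝ φ x e :=
    (hc.fderiv ℝ).comp_left (g := fun L : Space N →L[ℝ] ℝ => L e) (by simp)
  have t1 := tendsto_integral_mul_convolution_of_hasCompactSupport hφ' hc' hf.memLp hg.memLp hη hη1
  have t2 := tendsto_integral_mul_convolution_of_hasCompactSupport hφ.continuous hc
    hf.memLp hg.memLp' hη hη1
  have t3 := tendsto_integral_mul_convolution_of_hasCompactSupport hφ.continuous hc
    hf.memLp' hg.memLp hη hη1
  have key := tendsto_nhds_unique (t1.add t2) (t3.neg.congr fun n => ?_)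
  · have i1 : ∀ {k u v : Space N → ℝ}, Continuous k → HasCompactSupport k →
        MemLp u 2 (gaussianMeasure N) → MemLp v 2 (gaussianMeasure N) →
        Integrable fun x => k x * u x * v x := by
      intro k u v hk hkc hu hv
      obtain ⟨R, hR⟩ := hkc.isCompact.isBounded.subset_closedBall (0 : Space N)
      have := integrable_mul_of_memLp_two (memLp_indicator_closedBall hu R)
        (memLp_indicator_closedBall hv R)
      obtain ⟨C, hC⟩ := hk.bounded_above_of_compact_support hkc
      refine (this.bdd_mul hk.aestronglyMeasurable (ae_of_all _ hC)).congr (ae_of_all _ fun x => ?_)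
      by_cases hx : x ∈ closedBall (0 : Space N) R
      · simp only [Set.indicator_of_mem hx]; ring
      · have : k x = 0 := by
          by_contra h
          exact hx (hR (subset_tsupport _ h))
        simp [this]
    have e1 : ∫ x, φ x * (f' x * g x + f x * g' x)
        = (∫ x, φ x * f' x * g x) + ∫ x, φ x * f x * g' x := by
      rw [← integral_add (i1 hφ.continuous hc hf.memLp' hg.memLp)
        (i1 hφ.continuous hc hf.memLp hg.memLp')]
      refine integral_congr_ae (ae_of_all _ fun x => ?_)
      ring
    have e2 : ∫ x, fderiv ℝ φ x e * (f x * g x) = ∫ x, fderiv ℝ φ x e * f x * g x := by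
      simp only [mul_assoc]
    rw [e1, e2]
    linarith
  · set G := ((η n).normed volume ⋆[ContinuousLinearMap.lsmul ℝ ℝ] g) with hG
    have hGc : ContDiff ℝ ∞ G :=
      (η n).hasCompactSupport_normed.contDiff_convolution_left _ (η n).contDiff_normed hg.weak.1
    have hGd : ∀ x, fderiv ℝ G x e
        = ((η n).normed volume ⋆[ContinuousLinearMap.lsmul ℝ ℝ] g') x := fun x =>
      hg.weak.fderiv_convolution (η n).contDiff_normed (η n).hasCompactSupport_normed x
    -- With $g$ mollified to a smooth $G$, the product $\varphi G$ is a test function, so the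
    -- definition of the weak derivative of $f$ gives the Leibniz rule before the limit.
    have h := hf.weak.2.2 (fun x => φ x * G x) (hφ.mul hGc) hc.mul_right
    have hd : ∀ x, fderiv ℝ (fun x => φ x * G x) x e
        = fderiv ℝ φ x e * G x + φ x * fderiv ℝ G x e := by
      intro x
      rw [fderiv_fun_mul (hφ.differentiable (by simp) x) (hGc.differentiable (by simp) x)]
      simp
      ring
    have hG' : Continuous fun x => fderiv ℝ G x e :=
      (hGc.continuous_fderiv (by simp)).clm_apply continuous_const
    simp only [← hGd]
    rw [← integral_add]
    · have h' : ∫ x, (fderiv ℝ φ x e * f x * G x + φ x * f x * fderiv ℝ G x e)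
          = -∫ x, φ x * f' x * G x := by
        calc _ = ∫ x, fderiv ℝ (fun x => φ x * G x) x e • f x := by
              refine integral_congr_ae (ae_of_all _ fun x => ?_)
              simp only [hd, smul_eq_mul]; ring
          _ = _ := by
              rw [h]
              congr 1
              refine integral_congr_ae (ae_of_all _ fun x => ?_)
              simp only [smul_eq_mul]; ring
      exact h'.symm
    · refine (integrable_mul_of_hasCompactSupport (hφ'.mul hGc.continuous) hc'.mul_right
        hf.weak.1).congr (ae_of_all _ fun x => ?_)
      simp only [Pi.mul_apply]; ring
    · refine (integrable_mul_of_hasCompactSupport (hφ.continuous.mul hG') hc.mul_right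
        hf.weak.1).congr (ae_of_all _ fun x => ?_)
      simp only [Pi.mul_apply]; ring

/-! ### Limits of bounded integrals, cutoffs and Gaussian integration by parts. -/

theorem integrable_and_integral_le_of_tendsto {α : Type*} [MeasurableSpace α] {ν : Measure α}
    {F : ℕ → α → ℝ} {G : α → ℝ} {B : ℝ} (hF : ∀ n, Integrable (F n) ν)
    (h0 : ∀ n x, 0 ≤ F n x) (hB : ∀ n, ∫ x, F n x ∂ν ≤ B)
    (hlim : ∀ᵐ x ∂ν, Tendsto (fun n => F n x) atTop (𝓝 (G x))) :
    Integrable G ν ∧ ∫ x, G x ∂ν ≤ B := by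
  have hGm : AEStronglyMeasurable G ν :=
    aestronglyMeasurable_of_tendsto_ae atTop (fun n => (hF n).1) hlim
  have hG0 : 0 ≤ᵐ[ν] G := by
    filter_upwards [hlim] with x hx
    exact ge_of_tendsto' hx fun n => h0 n x
  have hB0 : 0 ≤ B := (integral_nonneg (h0 0)).trans (hB 0)
  have hle : ∫⁻ x, ENNReal.ofReal (G x) ∂ν ≤ ENNReal.ofReal B := by
    calc ∫⁻ x, ENNReal.ofReal (G x) ∂ν
        = ∫⁻ x, liminf (fun n => ENNReal.ofReal (F n x)) atTop ∂ν := by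
          refine lintegral_congr_ae ?_
          filter_upwards [hlim] with x hx
          exact ((ENNReal.continuous_ofReal.tendsto _).comp hx).liminf_eq.symm
      _ ≤ liminf (fun n => ∫⁻ x, ENNReal.ofReal (F n x) ∂ν) atTop :=
          lintegral_liminf_le' fun n => (hF n).1.aemeasurable.ennreal_ofReal
      _ ≤ liminf (fun _ : ℕ => ENNReal.ofReal B) atTop := by
          refine liminf_le_liminf (Eventually.of_forall fun n => ?_)
          rw [← ofReal_integral_eq_lintegral_ofReal (hF n) (ae_of_all _ (h0 n))]
          exact ENNReal.ofReal_le_ofReal (hB n)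
      _ = ENNReal.ofReal B := by simp
  refine ⟨⟨hGm, ?_⟩, ?_⟩
  · rw [hasFiniteIntegral_iff_ofReal hG0]
    exact hle.trans_lt ENNReal.ofReal_lt_top
  · rw [integral_eq_lintegral_of_nonneg_ae hG0 hGm]
    exact ENNReal.toReal_le_of_le_ofReal hB0 hle

/-- Gaussian integration by parts against a test function. -/
theorem MemGaussianH1.integral_mul_of_hasCompactSupport {i : Fin N} {f f' g g' : Space N → ℝ}
    (hf : MemGaussianH1 i f f') (hg : MemGaussianH1 i g g') {ψ : Space N → ℝ}
    (hψ : ContDiff ℝ ∞ ψ) (hc : HasCompactSupport ψ) :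
    ∫ x, (fderiv ℝ ψ x (EuclideanSpace.single i 1) - x i * ψ x) * (f x * g x) ∂(gaussianMeasure N)
      = -∫ x, ψ x * (f' x * g x + f x * g' x) ∂(gaussianMeasure N) := by
  -- The density goes into the test function; its derivative $-x_i\mu$ produces the drift term.
  have h := hf.integral_fderiv_mul hg (hψ.mul contDiff_gaussianDensity) hc.mul_right
  rw [integral_gaussianMeasure, integral_gaussianMeasure]
  calc _ = _ := integral_congr_ae (ae_of_all _ fun x => ?_)
    _ = _ := h
    _ = _ := by
      congr 1
      refine integral_congr_ae (ae_of_all _ fun x => ?_)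
      dsimp only; ring
  dsimp only
  rw [fderiv_fun_mul (hψ.differentiable (by simp) x)
    (contDiff_gaussianDensity.differentiable (by simp) x)]
  simp only [_root_.add_apply, _root_.smul_apply, smul_eq_mul,
    fderiv_gaussianDensity]
  ring

/-- Dilates $\chi(x/(n+1))$ of one bump: the gradient decays like $1/(n+1)$, while $x_iD_i\chi_n$ is
scale invariant and therefore only bounded. -/
theorem exists_cutoff (N : ℕ) : ∃ (C : ℝ) (χ : ℕ → Space N → ℝ), 0 ≤ C ∧
    (∀ n, ContDiff ℝ ∞ (χ n)) ∧ (∀ n, HasCompactSupport (χ n)) ∧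
    (∀ n x, 0 ≤ χ n x) ∧ (∀ n x, χ n x ≤ 1) ∧
    (∀ n x i, |fderiv ℝ (χ n) x (EuclideanSpace.single i 1)| ≤ C * (1 / ((n : ℝ) + 1))) ∧
    (∀ n x i, |x i * fderiv ℝ (χ n) x (EuclideanSpace.single i 1)| ≤ C) ∧
    (∀ x, Tendsto (fun n => χ n x) atTop (𝓝 1)) := by
  let χ : ContDiffBump (0 : Space N) := ⟨1, 2, by norm_num, by norm_num⟩
  have hd : Continuous (fderiv ℝ χ) := χ.contDiff.continuous_fderiv (n := ∞) (by simp)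
  have hdc : HasCompactSupport (fderiv ℝ χ) := χ.hasCompactSupport.fderiv ℝ
  obtain ⟨C₁, hC₁⟩ := hd.bounded_above_of_compact_support hdc
  obtain ⟨C₂, hC₂⟩ := (continuous_norm.smul hd).bounded_above_of_compact_support
    (hdc.smul_left (f := fun x : Space N => ‖x‖))
  have hs : ∀ n : ℕ, (0 : ℝ) < ((n : ℝ) + 1)⁻¹ := fun n => by positivity
  have hdn : ∀ (n : ℕ) (x : Space N) (i : Fin N),
      fderiv ℝ (fun x => χ (((n : ℝ) + 1)⁻¹ • x)) x (EuclideanSpace.single i 1)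
      = ((n : ℝ) + 1)⁻¹ * fderiv ℝ χ (((n : ℝ) + 1)⁻¹ • x) (EuclideanSpace.single i 1) := by
    intro n x i
    have h1 : HasFDerivAt (fun x : Space N => χ (((n : ℝ) + 1)⁻¹ • x)) _ x :=
      ((χ.contDiff (n := ⊤)).differentiable (by simp) _).hasFDerivAt.comp x
        ((hasFDerivAt_id x).const_smul (((n : ℝ) + 1)⁻¹))
    rw [h1.fderiv]
    simp
  have hn1 : ∀ i : Fin N, ‖(EuclideanSpace.single i (1 : ℝ) : Space N)‖ = 1 := by simp
  have happ : ∀ (y : Space N) (i : Fin N),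
      |fderiv ℝ χ y (EuclideanSpace.single i 1)| ≤ ‖fderiv ℝ χ y‖ := fun y i => by
    have := (fderiv ℝ χ y).le_opNorm (EuclideanSpace.single i 1)
    rwa [hn1, mul_one, Real.norm_eq_abs] at this
  refine ⟨max C₁ C₂, fun n x => χ (((n : ℝ) + 1)⁻¹ • x),
    le_max_of_le_left ((norm_nonneg _).trans (hC₁ 0)), fun n => ?_, fun n => ?_,
    fun n x => χ.nonneg, fun n x => χ.le_one, fun n x i => ?_, fun n x i => ?_, fun x => ?_⟩
  · exact χ.contDiff.comp (contDiff_id.const_smul (((n : ℝ) + 1)⁻¹))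
  · exact χ.hasCompactSupport.comp_smul (hs n).ne'
  · rw [hdn, abs_mul, abs_of_pos (hs n), one_div, mul_comm]
    gcongr
    exact ((happ _ i).trans (hC₁ _)).trans (le_max_left _ _)
  · rw [hdn]
    have h2 := hC₂ (((n : ℝ) + 1)⁻¹ • x)
    rw [Pi.smul_apply', norm_smul, norm_norm, norm_smul, Real.norm_eq_abs, abs_of_pos (hs n)] at h2
    refine le_trans ?_ (h2.trans (le_max_right _ _))
    rw [abs_mul, abs_mul, abs_of_pos (hs n), ← mul_assoc, mul_comm |x i|]
    gcongr
    · exact (Real.norm_eq_abs _).symm.le.trans (PiLp.norm_apply_le x i)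
    · exact happ _ i
  · have h1 : Tendsto (fun n : ℕ => ((n : ℝ) + 1)⁻¹ • x) atTop (𝓝 ((0 : ℝ) • x)) := by
      refine Tendsto.smul_const ?_ x
      simpa [one_div] using tendsto_one_div_add_atTop_nhds_zero_nat (𝕜 := ℝ)
    have h2 := (χ.continuous.tendsto ((0 : ℝ) • x)).comp h1
    have h3 : χ ((0 : ℝ) • x) = 1 := χ.one_of_mem_closedBall (by simp [χ])
    rw [h3] at h2
    exact h2

theorem hasFDerivAt_coord (x : Space N) (i : Fin N) :
    HasFDerivAt (fun x : Space N => x i) (EuclideanSpace.proj i : Space N →L[ℝ] ℝ) x :=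
  (EuclideanSpace.proj i : Space N →L[ℝ] ℝ).hasFDerivAt

theorem contDiff_coord (i : Fin N) : ContDiff ℝ ∞ fun x : Space N => x i :=
  (EuclideanSpace.proj i : Space N →L[ℝ] ℝ).contDiff

theorem continuous_coord (i : Fin N) : Continuous fun x : Space N => x i :=
  (contDiff_coord i).continuous

theorem integrable_mul_of_le {f : Space N → ℝ} {k : Space N → ℝ} {C : ℝ}
    (hf : Integrable f (gaussianMeasure N)) (hk : Continuous k) (hC : ∀ x, |k x| ≤ C) :
    Integrable (fun x => k x * f x) (gaussianMeasure N) :=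
  hf.bdd_mul hk.aestronglyMeasurable (ae_of_all _ hC)

theorem continuous_fderiv_single {ψ : Space N → ℝ} (hψ : ContDiff ℝ ∞ ψ) (i : Fin N) :
    Continuous fun x => fderiv ℝ ψ x (EuclideanSpace.single i 1) :=
  (hψ.continuous_fderiv (by simp)).clm_apply continuous_const

/-- Gaussian integration by parts against $x_i\chi_n$ expresses $\int x_i^2\chi_nf^2\,d\mu$ through
$f^2$ and $x_i\chi_nff'$. Half of the left side absorbs the mixed term, and the bound survives
$n\to\infty$ by Fatou. -/
theorem MemGaussianH1.memLp_coord_mul {i : Fin N} {f f' : Space N → ℝ}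
    (hf : MemGaussianH1 i f f') : MemLp (fun x => x i * f x) 2 (gaussianMeasure N) := by
  obtain ⟨C, χ, hC0, hχ, hχc, hχ0, hχ1, -, hχd, hχl⟩ := exists_cutoff N
  have hm : AEStronglyMeasurable (fun x => x i * f x) (gaussianMeasure N) :=
    (continuous_coord i).aestronglyMeasurable.mul hf.memLp.1
  rw [memLp_two_iff_integrable_sq hm]
  have hff := hf.memLp.integrable_sq
  have hff' := hf.memLp'.integrable_sq
  have hb : ∀ n, ∃ B, ∀ x, |x i ^ 2 * χ n x| ≤ B := fun n =>
    (((continuous_coord i).pow 2).mul (hχ n).continuous).bounded_above_of_compact_support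
      (hχc n).mul_left
  have hb' : ∀ n, ∃ B, ∀ x, |x i * χ n x| ≤ B := fun n =>
    ((continuous_coord i).mul (hχ n).continuous).bounded_above_of_compact_support
      (hχc n).mul_left
  have hI : ∀ n, Integrable (fun x => x i ^ 2 * χ n x * f x ^ 2) (gaussianMeasure N) := by
    intro n
    obtain ⟨B, hB⟩ := hb n
    exact integrable_mul_of_le hff (((continuous_coord i).pow 2).mul (hχ n).continuous) hB
  refine (integrable_and_integral_le_of_tendsto (F := fun n x => x i ^ 2 * χ n x * f x ^ 2)
    (B := 2 * ((1 + C) * ∫ x, f x ^ 2 ∂(gaussianMeasure N) +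
      2 * ∫ x, f' x ^ 2 ∂(gaussianMeasure N))) hI
    (fun n x => mul_nonneg (mul_nonneg (sq_nonneg _) (hχ0 n x)) (sq_nonneg _)) (fun n => ?_)
    (ae_of_all _ fun x => ?_)).1
  · have hibp := hf.integral_mul_of_hasCompactSupport hf
      ((contDiff_coord i).mul (hχ n)) (hχc n).mul_left
    have hder : ∀ x : Space N, fderiv ℝ (fun x : Space N => x i * χ n x) x
        (EuclideanSpace.single i 1)
        = χ n x + x i * fderiv ℝ (χ n) x (EuclideanSpace.single i 1) := by
      intro x
      have := (hasFDerivAt_coord x i).mul ((hχ n).differentiable (by simp) x).hasFDerivAt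
      have h2 : HasFDerivAt (fun x : Space N => x i * χ n x) _ x := this
      rw [h2.fderiv]
      simp
      ring
    simp only [hder] at hibp
    have i1 : Integrable (fun x => (χ n x + x i * fderiv ℝ (χ n) x (EuclideanSpace.single i 1))
        * f x ^ 2) (gaussianMeasure N) := by
      refine integrable_mul_of_le (C := 1 + C) hff ((hχ n).continuous.add
        ((continuous_coord i).mul (continuous_fderiv_single (hχ n) i))) fun x => ?_
      refine (abs_add_le _ _).trans (add_le_add ?_ (hχd n x i))
      rw [abs_of_nonneg (hχ0 n x)]
      exact hχ1 n x
    have i2 : Integrable (fun x => x i * χ n x * (f' x * f x + f x * f' x))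
        (gaussianMeasure N) := by
      obtain ⟨B, hB⟩ := hb' n
      exact integrable_mul_of_le ((integrable_mul_of_memLp_two hf.memLp' hf.memLp).add
        (integrable_mul_of_memLp_two hf.memLp hf.memLp'))
        ((continuous_coord i).mul (hχ n).continuous) hB
    have e1 : ∫ x, x i ^ 2 * χ n x * f x ^ 2 ∂(gaussianMeasure N)
        = ∫ x, ((χ n x + x i * fderiv ℝ (χ n) x (EuclideanSpace.single i 1)) * f x ^ 2
          + x i * χ n x * (f' x * f x + f x * f' x)) ∂(gaussianMeasure N) := by
      rw [integral_add i1 i2, ← sub_eq_iff_eq_add', ← neg_eq_iff_eq_neg.2 hibp, ← integral_neg,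
        ← integral_sub (hI n) i1]
      refine integral_congr_ae (ae_of_all _ fun x => ?_)
      dsimp only; ring
    have i3 : Integrable (fun x => 2⁻¹ * (x i ^ 2 * χ n x * f x ^ 2) + 2 * f' x ^ 2)
        (gaussianMeasure N) := ((hI n).const_mul _).add (hff'.const_mul _)
    have e2 : ∫ x, x i ^ 2 * χ n x * f x ^ 2 ∂(gaussianMeasure N) ≤
        ∫ x, ((1 + C) * f x ^ 2 + (2⁻¹ * (x i ^ 2 * χ n x * f x ^ 2) + 2 * f' x ^ 2))
          ∂(gaussianMeasure N) := by
      rw [e1]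
      refine integral_mono (i1.add i2) ((hff.const_mul _).add i3) fun x => ?_
      have h1 := le_of_abs_le (hχd n x i)
      have h2 := hχ1 n x
      have h3 := hχ0 n x
      dsimp only [Pi.add_apply]
      have h4 : (χ n x + x i * fderiv ℝ (χ n) x (EuclideanSpace.single i 1)) * f x ^ 2
          ≤ (1 + C) * f x ^ 2 := by gcongr
      -- Young's inequality $2x_iff'\le\frac12x_i^2f^2+2f'^2$, weighted by $\chi_n\le1$; the factor
      -- $\frac12$ makes absorption possible.
      nlinarith [mul_nonneg h3 (sq_nonneg (x i * f x - 2 * f' x)),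
        mul_nonneg (sub_nonneg.2 h2) (sq_nonneg (f' x))]
    rw [integral_add (hff.const_mul _) i3,
      integral_add ((hI n).const_mul _) (hff'.const_mul _), integral_const_mul, integral_const_mul,
      integral_const_mul] at e2
    linarith
  · have := ((hχl x).const_mul (x i ^ 2)).mul_const (f x ^ 2)
    simpa [mul_pow] using this

/-- Gaussian integration by parts against a smooth function bounded with its derivative. -/
theorem MemGaussianH1.integral_mul {i : Fin N} {f f' g g' : Space N → ℝ}
    (hf : MemGaussianH1 i f f') (hg : MemGaussianH1 i g g') {ψ ψ' : Space N → ℝ}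
    (hψ : ContDiff ℝ ∞ ψ) (hψ' : ∀ x, fderiv ℝ ψ x (EuclideanSpace.single i 1) = ψ' x)
    {K : ℝ} (hK : ∀ x, |ψ x| ≤ K) (hK' : ∀ x, |ψ' x| ≤ K) :
    ∫ x, (ψ' x - x i * ψ x) * (f x * g x) ∂(gaussianMeasure N)
      = -∫ x, ψ x * (f' x * g x + f x * g' x) ∂(gaussianMeasure N) := by
  obtain ⟨C, χ, hC0, hχ, hχc, hχ0, hχ1, hχd, -, hχl⟩ := exists_cutoff N
  have hK0 : 0 ≤ K := (abs_nonneg _).trans (hK 0)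
  have hfg := integrable_mul_of_memLp_two hf.memLp hg.memLp
  -- The unbounded factor $x_i$ in the drift is dominated thanks to $x_if\in L^2_\mu$.
  have hxfg := integrable_mul_of_memLp_two hf.memLp_coord_mul hg.memLp
  have hD := (integrable_mul_of_memLp_two hf.memLp' hg.memLp).add
    (integrable_mul_of_memLp_two hf.memLp hg.memLp')
  have hψ'c : Continuous ψ' := by
    have := continuous_fderiv_single hψ i
    simpa only [hψ'] using this
  have hder : ∀ n x, fderiv ℝ (fun x => ψ x * χ n x) x (EuclideanSpace.single i 1)
      = ψ' x * χ n x + ψ x * fderiv ℝ (χ n) x (EuclideanSpace.single i 1) := by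
    intro n x
    rw [fderiv_fun_mul (hψ.differentiable (by simp) x) ((hχ n).differentiable (by simp) x),
      ← hψ' x]
    simp
    ring
  have hibp := fun n => hf.integral_mul_of_hasCompactSupport hg (hψ.mul (hχ n)) (hχc n).mul_left
  simp only [hder] at hibp
  have hχabs : ∀ n x, |χ n x| ≤ 1 := fun n x => by
    rw [abs_of_nonneg (hχ0 n x)]; exact hχ1 n x
  have hdabs : ∀ n x, |fderiv ℝ (χ n) x (EuclideanSpace.single i 1)| ≤ C := fun n x => by
    refine (hχd n x i).trans (mul_le_of_le_one_right hC0 ?_)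
    rw [div_le_one (by positivity)]
    simp
  have hd0 : ∀ x, Tendsto (fun n => fderiv ℝ (χ n) x (EuclideanSpace.single i 1)) atTop (𝓝 0) := by
    intro x
    have : Tendsto (fun n : ℕ => C * (1 / ((n : ℝ) + 1))) atTop (𝓝 0) := by
      simpa using (tendsto_one_div_add_atTop_nhds_zero_nat (𝕜 := ℝ)).const_mul C
    exact squeeze_zero_norm (fun n => hχd n x i) this
  have T1 : Tendsto (fun n => ∫ x, (ψ' x * χ n x + ψ x * fderiv ℝ (χ n) x
      (EuclideanSpace.single i 1) - x i * (ψ x * χ n x)) * (f x * g x) ∂(gaussianMeasure N)) atTop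
      (𝓝 (∫ x, (ψ' x - x i * ψ x) * (f x * g x) ∂(gaussianMeasure N))) := by
    refine tendsto_integral_of_dominated_convergence
      (fun x => (K + K * C) * |f x * g x| + K * |x i * f x * g x|) (fun n => ?_)
      ((hfg.abs.const_mul _).add (hxfg.abs.const_mul _)) (fun n => ae_of_all _ fun x => ?_)
      (ae_of_all _ fun x => ?_)
    · refine AEStronglyMeasurable.mul (Continuous.aestronglyMeasurable ?_) hfg.1
      exact ((hψ'c.mul (hχ n).continuous).add (hψ.continuous.mul
        (continuous_fderiv_single (hχ n) i))).sub ((continuous_coord i).mul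
        (hψ.continuous.mul (hχ n).continuous))
    · rw [norm_mul, Real.norm_eq_abs, Real.norm_eq_abs, mul_assoc (x i), abs_mul (x i),
        ← mul_assoc K, ← add_mul]
      gcongr
      refine (abs_sub _ _).trans (add_le_add ((abs_add_le _ _).trans (add_le_add ?_ ?_)) ?_)
      · rw [abs_mul]
        exact (mul_le_mul (hK' x) (hχabs n x) (abs_nonneg _) hK0).trans_eq (mul_one K)
      · rw [abs_mul]
        exact mul_le_mul (hK x) (hdabs n x) (abs_nonneg _) hK0
      · rw [abs_mul, mul_comm, abs_mul]
        gcongr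
        exact (mul_le_mul (hK x) (hχabs n x) (abs_nonneg _) hK0).trans_eq (mul_one K)
    · have h1 := ((((hχl x).const_mul (ψ' x)).add ((hd0 x).const_mul (ψ x))).sub
        (((hχl x).const_mul (ψ x)).const_mul (x i))).mul_const (f x * g x)
      simpa using h1
  have T2 : Tendsto (fun n => ∫ x, ψ x * χ n x * (f' x * g x + f x * g' x) ∂(gaussianMeasure N))
      atTop (𝓝 (∫ x, ψ x * (f' x * g x + f x * g' x) ∂(gaussianMeasure N))) := by
    refine tendsto_integral_of_dominated_convergence
      (fun x => K * |f' x * g x + f x * g' x|) (fun n => ?_) (hD.abs.const_mul _)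
      (fun n => ae_of_all _ fun x => ?_) (ae_of_all _ fun x => ?_)
    · exact (hψ.continuous.mul (hχ n).continuous).aestronglyMeasurable.mul hD.1
    · rw [norm_mul, Real.norm_eq_abs, Real.norm_eq_abs]
      gcongr
      rw [abs_mul]
      exact (mul_le_mul (hK x) (hχabs n x) (abs_nonneg _) hK0).trans_eq (mul_one K)
    · have h1 := ((hχl x).const_mul (ψ x)).mul_const (f' x * g x + f x * g' x)
      simpa using h1
  exact tendsto_nhds_unique T1 (T2.neg.congr fun n => (hibp n).symm)

/-! ### The regularised weight and its divergence identities. -/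

/-- The regularised weight `1 / (|x|² + ε)`. -/
def regInv (ε : ℝ) (x : Space N) : ℝ := (‖x‖ ^ 2 + ε)⁻¹

/-- The form in which every completed square is used: $z$ is a sum of divergences, so a pointwise
inequality need only hold modulo $z$. -/
theorem integral_le_of_le_add {α : Type*} [MeasurableSpace α] {ν : Measure α} {f g z : α → ℝ}
    (hf : Integrable f ν) (hg : Integrable g ν) (hz : Integrable z ν) (h0 : ∫ x, z x ∂ν = 0)
    (h : ∀ x, f x ≤ g x + z x) : ∫ x, f x ∂ν ≤ ∫ x, g x ∂ν := by
  have := integral_mono hf (hg.add hz) h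
  simp only [Pi.add_apply] at this
  rwa [integral_add hg hz, h0, add_zero] at this

theorem regInv_pos {ε : ℝ} (hε : 0 < ε) (x : Space N) : 0 < regInv ε x := by
  unfold regInv; positivity

theorem normSq_mul_regInv_le {ε : ℝ} (hε : 0 < ε) (x : Space N) : ‖x‖ ^ 2 * regInv ε x ≤ 1 := by
  unfold regInv
  rw [← div_eq_mul_inv, div_le_one (by positivity)]
  linarith

/-- The extra $1$ lets one constant also control $x_i(|x|^2+\varepsilon)^{-1}$, through
$|x_i|\le1+|x|^2$. -/
theorem regInv_le {ε : ℝ} (hε : 0 < ε) (x : Space N) : regInv ε x ≤ ε⁻¹ + 1 := by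
  have : regInv ε x ≤ ε⁻¹ := by
    unfold regInv
    gcongr
    simp
  linarith

theorem abs_coord_mul_regInv_le {ε : ℝ} (hε : 0 < ε) (x : Space N) (i : Fin N) :
    |x i * regInv ε x| ≤ ε⁻¹ + 1 := by
  have h0 := regInv_pos hε x
  have h1 : regInv ε x ≤ ε⁻¹ := by
    unfold regInv
    gcongr
    simp
  have h2 := normSq_mul_regInv_le hε x
  have h3 : |x i| ≤ ‖x‖ := (Real.norm_eq_abs _).symm.le.trans (PiLp.norm_apply_le x i)
  rw [abs_mul, abs_of_pos h0]
  have h4 : |x i| ≤ 1 + ‖x‖ ^ 2 := by nlinarith [sq_nonneg (‖x‖ - 1)]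
  nlinarith

theorem contDiff_regInv {ε : ℝ} (hε : 0 < ε) : ContDiff ℝ ∞ (regInv ε : Space N → ℝ) :=
  ((contDiff_norm_sq ℝ).add contDiff_const).inv fun x => by positivity

theorem fderiv_regInv {ε : ℝ} (hε : 0 < ε) (x : Space N) (i : Fin N) :
    fderiv ℝ (regInv ε) x (EuclideanSpace.single i 1) = -2 * x i * regInv ε x ^ 2 := by
  have h1 : HasFDerivAt (fun x : Space N => ‖x‖ ^ 2 + ε) (2 • innerSL ℝ x) x :=
    (hasStrictFDerivAt_norm_sq x).hasFDerivAt.add_const ε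
  have h2 : HasFDerivAt (regInv ε) _ x :=
    (hasDerivAt_inv (show ‖x‖ ^ 2 + ε ≠ 0 by positivity)).comp_hasFDerivAt x h1
  rw [h2.fderiv]
  simp [regInv, EuclideanSpace.inner_single_right]
  ring

theorem fderiv_coord_mul_regInv_pow {ε : ℝ} (hε : 0 < ε) (x : Space N) (i : Fin N) (k : ℕ) :
    fderiv ℝ (fun x : Space N => x i * regInv ε x ^ (k + 1)) x (EuclideanSpace.single i 1)
      = regInv ε x ^ (k + 1) - 2 * (k + 1) * (x i ^ 2 * regInv ε x ^ (k + 2)) := by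
  have h1 := ((contDiff_regInv hε).differentiable (by simp) x).hasFDerivAt
  have h2 : HasFDerivAt (fun x : Space N => x i * regInv ε x ^ (k + 1)) _ x :=
    (hasFDerivAt_coord x i).mul (h1.pow (k + 1))
  rw [h2.fderiv]
  simp [fderiv_regInv hε]
  ring

/-- The $i$-th part of the Gaussian divergence of $t^{k+1}u^2x$. The case $k=0$ serves Hardy's
inequality and $k=1$ serves Rellich's. -/
theorem MemGaussianH1.integral_coord_mul_regInv_pow {ε : ℝ} (hε : 0 < ε) {i : Fin N}
    {u p : Space N → ℝ}
    (hu : MemGaussianH1 i u p) (k : ℕ) :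
    ∫ x, ((regInv ε x ^ (k + 1) - 2 * (k + 1) * (x i ^ 2 * regInv ε x ^ (k + 2))
      - x i ^ 2 * regInv ε x ^ (k + 1)) * u x ^ 2
      + 2 * (x i * regInv ε x ^ (k + 1)) * (p x * u x)) ∂(gaussianMeasure N) = 0 ∧
    Integrable (fun x => (regInv ε x ^ (k + 1) - 2 * (k + 1) * (x i ^ 2 * regInv ε x ^ (k + 2))
      - x i ^ 2 * regInv ε x ^ (k + 1)) * u x ^ 2
      + 2 * (x i * regInv ε x ^ (k + 1)) * (p x * u x)) (gaussianMeasure N) := by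
  set M : ℝ := ε⁻¹ + 1
  have hM : 0 ≤ M := by positivity
  have ht : ∀ x : Space N, |regInv ε x| ≤ M := fun x => by
    rw [abs_of_pos (regInv_pos hε x)]; exact regInv_le hε x
  have hxt := fun x : Space N => abs_coord_mul_regInv_le hε x i
  have b1 : ∀ (x : Space N) (k : ℕ), |regInv ε x ^ k| ≤ M ^ k := fun x k => by
    rw [abs_pow]; gcongr; exact ht x
  have b2 : ∀ x : Space N, |x i * regInv ε x ^ (k + 1)| ≤ M ^ (k + 1) := fun x => by
    rw [pow_succ', ← mul_assoc, abs_mul, pow_succ']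
    exact mul_le_mul (hxt x) (b1 x k) (abs_nonneg _) hM
  have b3 : ∀ x : Space N, |x i ^ 2 * regInv ε x ^ (k + 2)| ≤ M ^ (k + 2) := fun x => by
    have : x i ^ 2 * regInv ε x ^ (k + 2) = (x i * regInv ε x) ^ 2 * regInv ε x ^ k := by ring
    rw [this, abs_mul, abs_pow, add_comm, pow_add]
    gcongr
    exacts [hxt x, b1 x k]
  have b4 : ∀ x : Space N, |regInv ε x ^ (k + 1) - 2 * (k + 1) * (x i ^ 2 * regInv ε x ^ (k + 2))|
      ≤ M ^ (k + 1) + 2 * (k + 1) * M ^ (k + 2) := fun x => by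
    refine (abs_sub _ _).trans (add_le_add (b1 x _) ?_)
    rw [abs_mul, abs_of_nonneg (by positivity)]
    gcongr
    exact b3 x
  have c1 : ContDiff ℝ ∞ fun x : Space N => x i * regInv ε x ^ (k + 1) :=
    (contDiff_coord i).mul ((contDiff_regInv hε).pow _)
  have h := hu.integral_mul hu c1 (fun x => fderiv_coord_mul_regInv_pow hε x i k)
    (K := M ^ (k + 1) + 2 * (k + 1) * M ^ (k + 2))
    (fun x => (b2 x).trans (le_add_of_nonneg_right (by positivity))) b4
  have hct : Continuous (regInv ε : Space N → ℝ) := (contDiff_regInv hε).continuous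
  have i1 : Integrable (fun x => (regInv ε x ^ (k + 1)
      - 2 * (k + 1) * (x i ^ 2 * regInv ε x ^ (k + 2)) - x i ^ 2 * regInv ε x ^ (k + 1)) * u x ^ 2)
      (gaussianMeasure N) := by
    have j1 := integrable_mul_of_le hu.memLp.integrable_sq (show Continuous fun x : Space N =>
      regInv ε x ^ (k + 1) - 2 * (k + 1) * (x i ^ 2 * regInv ε x ^ (k + 2)) from
      (hct.pow (k + 1)).sub
      (((((continuous_coord i).pow 2).mul (hct.pow (k + 2)))).const_mul (2 * ((k : ℝ) + 1)))) b4
    have j2 := integrable_mul_of_le (integrable_mul_of_memLp_two hu.memLp_coord_mul hu.memLp)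
      c1.continuous b2
    refine (j1.sub j2).congr (ae_of_all _ fun x => ?_)
    simp only [Pi.sub_apply]; ring
  have i2 : Integrable (fun x => 2 * (x i * regInv ε x ^ (k + 1)) * (p x * u x))
      (gaussianMeasure N) := by
    refine ((integrable_mul_of_le (integrable_mul_of_memLp_two hu.memLp' hu.memLp)
      c1.continuous b2).const_mul 2).congr (ae_of_all _ fun x => ?_)
    dsimp only; ring
  refine ⟨?_, i1.add i2⟩
  rw [integral_add i1 i2]
  have e1 : ∫ x, (regInv ε x ^ (k + 1)
      - 2 * (k + 1) * (x i ^ 2 * regInv ε x ^ (k + 2)) - x i ^ 2 * regInv ε x ^ (k + 1)) * u x ^ 2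
      ∂(gaussianMeasure N) = _ := Eq.trans (integral_congr_ae (ae_of_all _ fun x => by
        dsimp only; ring)) h
  rw [e1, neg_add_eq_zero]
  refine integral_congr_ae (ae_of_all _ fun x => ?_)
  dsimp only; ring

/-- The $i$-th part of the Gaussian divergence of $tu\nabla u$; summed over $i$ it links $t\,u\,Lu$
with $t|\nabla u|^2$. -/
theorem MemGaussianH1.integral_regInv_mul {ε : ℝ} (hε : 0 < ε) {i : Fin N} {u p q : Space N → ℝ}
    (hu : MemGaussianH1 i u p) (hp : MemGaussianH1 i p q) :
    ∫ x, ((-2 * x i * regInv ε x ^ 2 - x i * regInv ε x) * (p x * u x)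
      + regInv ε x * (q x * u x + p x * p x)) ∂(gaussianMeasure N) = 0 ∧
    Integrable (fun x => (-2 * x i * regInv ε x ^ 2 - x i * regInv ε x) * (p x * u x)
      + regInv ε x * (q x * u x + p x * p x)) (gaussianMeasure N) := by
  set M : ℝ := ε⁻¹ + 1
  have hM : 0 ≤ M := by positivity
  have ht : ∀ x : Space N, |regInv ε x| ≤ M := fun x => by
    rw [abs_of_pos (regInv_pos hε x)]; exact regInv_le hε x
  have hxt := fun x : Space N => abs_coord_mul_regInv_le hε x i
  have hct : Continuous (regInv ε : Space N → ℝ) := (contDiff_regInv hε).continuous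
  have b2 : ∀ x : Space N, |-2 * x i * regInv ε x ^ 2| ≤ 2 * (M * M) := fun x => by
    have : -2 * x i * regInv ε x ^ 2 = -2 * ((x i * regInv ε x) * regInv ε x) := by ring
    rw [this, abs_mul, abs_mul (x i * _)]
    simp only [abs_neg, Nat.abs_ofNat]
    gcongr
    exacts [hxt x, ht x]
  have h := hp.integral_mul hu (contDiff_regInv hε) (fun x => fderiv_regInv hε x i)
    (K := M + 2 * (M * M)) (fun x => (ht x).trans (le_add_of_nonneg_right (by positivity)))
    (fun x => (b2 x).trans (le_add_of_nonneg_left (by positivity)))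
  have i1 : Integrable (fun x => (-2 * x i * regInv ε x ^ 2 - x i * regInv ε x) * (p x * u x))
      (gaussianMeasure N) :=
    integrable_mul_of_le (C := 2 * (M * M) + M) (integrable_mul_of_memLp_two hu.memLp' hu.memLp)
      ((((continuous_coord i).const_mul (-2)).mul (hct.pow 2)).sub ((continuous_coord i).mul hct))
      fun x => (abs_sub _ _).trans (add_le_add (b2 x) (hxt x))
  have i2 : Integrable (fun x => regInv ε x * (q x * u x + p x * p x)) (gaussianMeasure N) :=
    integrable_mul_of_le ((integrable_mul_of_memLp_two hp.memLp' hu.memLp).add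
      (integrable_mul_of_memLp_two hp.memLp hp.memLp)) hct ht
  refine ⟨?_, i1.add i2⟩
  rw [integral_add i1 i2, h, neg_add_cancel]

/-! ### Hardy and Rellich inequalities for real functions. -/

/-- Expand $|\nabla u+tux|^2\ge0$ and add the divergence of $tu^2x$. No sharp constant is needed,
since this term only enters the lower-order part; $|x|^2t\le1$ and $N\ge5$ leave room to spare. -/
theorem integral_regInv_le {ε : ℝ} (hε : 0 < ε) (hN : 5 ≤ N)
    {u : Space N → ℝ} {p : Fin N → Space N → ℝ}
    (hu : ∀ i, MemGaussianH1 i u (p i)) :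
    ∫ x, regInv ε x * u x ^ 2 ∂(gaussianMeasure N) ≤
      (∫ x, u x ^ 2 ∂(gaussianMeasure N)) + ∫ x, ∑ i, p i x ^ 2 ∂(gaussianMeasure N) := by
  have hu2 := (hu ⟨0, by omega⟩).memLp.integrable_sq
  have hp2 : Integrable (fun x => ∑ i, p i x ^ 2) (gaussianMeasure N) :=
    integrable_finsetSum _ fun i _ => (hu i).memLp'.integrable_sq
  have ht : Integrable (fun x => regInv ε x * u x ^ 2) (gaussianMeasure N) :=
    integrable_mul_of_le (C := ε⁻¹ + 1) hu2 (contDiff_regInv hε).continuous fun x => by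
      rw [abs_of_pos (regInv_pos hε x)]; exact regInv_le hε x
  have hB := fun i => (hu i).integral_coord_mul_regInv_pow hε 0
  have hBs := integral_finsetSum (μ := gaussianMeasure N) Finset.univ fun i _ => (hB i).2
  rw [Finset.sum_eq_zero fun i _ => (hB i).1] at hBs
  have hBi := integrable_finsetSum (μ := gaussianMeasure N) Finset.univ fun i _ => (hB i).2
  rw [← integral_add hu2 hp2]
  refine integral_le_of_le_add ht (hu2.add hp2) hBi hBs fun x => ?_
  have h0 := regInv_pos hε x
  have h1 := normSq_mul_regInv_le hε x
  set t := regInv ε x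
  have hX : ‖x‖ ^ 2 = ∑ i, x i ^ 2 := EuclideanSpace.real_norm_sq_eq x
  have hsq : 0 ≤ ∑ i, (p i x + t * u x * x i) ^ 2 := Finset.sum_nonneg fun i _ => sq_nonneg _
  have e1 : ∑ i, (p i x + t * u x * x i) ^ 2
      = ∑ i, p i x ^ 2 + 2 * t * u x * ∑ i, x i * p i x + t ^ 2 * u x ^ 2 * ‖x‖ ^ 2 := by
    rw [hX]
    simp only [Finset.mul_sum, ← Finset.sum_add_distrib]
    refine Finset.sum_congr rfl fun i _ => ?_
    ring
  have e2 : ∑ i, ((t ^ (0 + 1) - 2 * (((0 : ℕ) : ℝ) + 1) * (x i ^ 2 * t ^ (0 + 2))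
      - x i ^ 2 * t ^ (0 + 1)) * u x ^ 2 + 2 * (x i * t ^ (0 + 1)) * (p i x * u x))
      = (N * t - 2 * ‖x‖ ^ 2 * t ^ 2 - ‖x‖ ^ 2 * t) * u x ^ 2
        + 2 * t * u x * ∑ i, x i * p i x := by
    have : (N : ℝ) * t = ∑ i : Fin N, t := by simp
    rw [this, hX]
    simp only [Finset.mul_sum, Finset.sum_mul, ← Finset.sum_sub_distrib, ← Finset.sum_add_distrib]
    refine Finset.sum_congr rfl fun i _ => ?_
    push_cast
    ring
  simp only [e2]
  rw [e1] at hsq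
  have hN' : (5 : ℝ) ≤ N := by exact_mod_cast hN
  have k1 : 0 ≤ u x ^ 2 * (1 - ‖x‖ ^ 2 * t) := mul_nonneg (sq_nonneg _) (sub_nonneg.2 h1)
  have k2 : 0 ≤ (u x ^ 2 * t) * (1 - ‖x‖ ^ 2 * t) := mul_nonneg (by positivity) (sub_nonneg.2 h1)
  have k3 : 0 ≤ (N - 5) * (t * u x ^ 2) := mul_nonneg (by linarith) (by positivity)
  have k4 : 0 ≤ t * u x ^ 2 := by positivity
  nlinarith

/-- The Rellich inequality for the regularised weight. -/
theorem integral_regInv_sq_le {ε : ℝ} (hε : 0 < ε) (hN : 5 ≤ N)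
    {u : Space N → ℝ} {p q : Fin N → Space N → ℝ}
    (hu : ∀ i, MemGaussianH1 i u (p i)) (hp : ∀ i, MemGaussianH1 i (p i) (q i)) {a κ : ℝ}
    (ha : a = ((N : ℝ) - 4) / 2) (hκ : κ = a ^ 2 + 2 * a) :
    κ ^ 2 * ∫ x, regInv ε x ^ 2 * u x ^ 2 ∂(gaussianMeasure N) ≤
      (∫ x, (∑ i, q i x - ∑ i, x i * p i x) ^ 2 ∂(gaussianMeasure N)) +
        2 * κ * (a + 1) * ∫ x, regInv ε x * u x ^ 2 ∂(gaussianMeasure N) := by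
  have hN' : (5 : ℝ) ≤ N := by exact_mod_cast hN
  have ha0 : 0 < a := by rw [ha]; linarith
  have hκ0 : 0 < κ := by rw [hκ]; positivity
  have hcu := (hu ⟨0, by omega⟩).memLp
  have hct : Continuous (regInv ε : Space N → ℝ) := (contDiff_regInv hε).continuous
  have hbt : ∀ x : Space N, |regInv ε x| ≤ ε⁻¹ + 1 := fun x => by
    rw [abs_of_pos (regInv_pos hε x)]; exact regInv_le hε x
  have ht : Integrable (fun x => regInv ε x * u x ^ 2) (gaussianMeasure N) :=
    integrable_mul_of_le hcu.integrable_sq hct hbt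
  have ht2 : Integrable (fun x => regInv ε x ^ 2 * u x ^ 2) (gaussianMeasure N) :=
    integrable_mul_of_le (C := (ε⁻¹ + 1) ^ 2) hcu.integrable_sq (hct.pow 2) fun x => by
      rw [abs_pow]; gcongr; exact hbt x
  have hL : Integrable (fun x => (∑ i, q i x - ∑ i, x i * p i x) ^ 2) (gaussianMeasure N) :=
    ((memLp_finsetSum _ fun i _ => (hp i).memLp').sub
      (memLp_finsetSum _ fun i _ => (hp i).memLp_coord_mul)).integrable_sq
  have hA := fun i => (hu i).integral_regInv_mul hε (hp i)
  have hB := fun i => (hu i).integral_coord_mul_regInv_pow hε 1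
  have hAs := integral_finsetSum (μ := gaussianMeasure N) Finset.univ fun i _ => (hA i).2
  rw [Finset.sum_eq_zero fun i _ => (hA i).1] at hAs
  have hAi := integrable_finsetSum (μ := gaussianMeasure N) Finset.univ fun i _ => (hA i).2
  have hBs := integral_finsetSum (μ := gaussianMeasure N) Finset.univ fun i _ => (hB i).2
  rw [Finset.sum_eq_zero fun i _ => (hB i).1] at hBs
  have hBi := integrable_finsetSum (μ := gaussianMeasure N) Finset.univ fun i _ => (hB i).2
  -- The multipliers $2\kappa$ and $2\kappa(a+1)$ match the cross terms of $(Lu+\kappa tu)^2$ and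
  -- $2\kappa t|\nabla u+atux|^2$.
  have hz := integral_add (hAi.const_mul (2 * κ)) (hBi.const_mul (2 * κ * (a + 1)))
  rw [integral_const_mul, integral_const_mul, hAs, hBs, mul_zero, mul_zero, add_zero] at hz
  rw [← integral_const_mul, ← integral_const_mul, ← integral_add hL (ht.const_mul _)]
  refine integral_le_of_le_add (ht2.const_mul _) (hL.add (ht.const_mul _))
    ((hAi.const_mul _).add (hBi.const_mul _)) hz fun x => ?_
  simp only [Pi.add_apply]
  have h0 := regInv_pos hε x
  have h1 := normSq_mul_regInv_le hε x
  set t := regInv ε x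
  have hX : ‖x‖ ^ 2 = ∑ i, x i ^ 2 := EuclideanSpace.real_norm_sq_eq x
  have hsq : 0 ≤ ∑ i, (p i x + a * t * u x * x i) ^ 2 := Finset.sum_nonneg fun i _ => sq_nonneg _
  have e1 : ∑ i, (p i x + a * t * u x * x i) ^ 2 = ∑ i, p i x ^ 2
      + 2 * a * t * u x * ∑ i, x i * p i x + a ^ 2 * t ^ 2 * u x ^ 2 * ‖x‖ ^ 2 := by
    rw [hX]
    simp only [Finset.mul_sum, ← Finset.sum_add_distrib]
    refine Finset.sum_congr rfl fun i _ => ?_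
    ring
  have e2 : ∑ i, ((t ^ (1 + 1) - 2 * (((1 : ℕ) : ℝ) + 1) * (x i ^ 2 * t ^ (1 + 2))
      - x i ^ 2 * t ^ (1 + 1)) * u x ^ 2 + 2 * (x i * t ^ (1 + 1)) * (p i x * u x))
      = (N * t ^ 2 - 4 * ‖x‖ ^ 2 * t ^ 3 - ‖x‖ ^ 2 * t ^ 2) * u x ^ 2
        + 2 * t ^ 2 * u x * ∑ i, x i * p i x := by
    have : (N : ℝ) * t ^ 2 = ∑ i : Fin N, t ^ 2 := by simp
    rw [this, hX]
    simp only [Finset.mul_sum, Finset.sum_mul, ← Finset.sum_sub_distrib, ← Finset.sum_add_distrib]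
    refine Finset.sum_congr rfl fun i _ => ?_
    push_cast
    ring
  have e3 : ∑ i, ((-2 * x i * t ^ 2 - x i * t) * (p i x * u x)
      + t * (q i x * u x + p i x * p i x))
      = (-2 * t ^ 2 - t) * u x * (∑ i, x i * p i x) + t * u x * (∑ i, q i x)
        + t * ∑ i, p i x ^ 2 := by
    simp only [Finset.mul_sum, ← Finset.sum_add_distrib]
    refine Finset.sum_congr rfl fun i _ => ?_
    ring
  simp only [e2, e3]
  rw [← sub_nonneg]
  rw [e1] at hsq
  set X := ‖x‖ ^ 2
  set S := ∑ i, x i * p i x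
  set Q := ∑ i, q i x
  set P := ∑ i, p i x ^ 2
  have hid : (N : ℝ) = 2 * a + 4 := by rw [ha]; ring
  have k2 : 0 ≤ (u x ^ 2 * t) * (1 - X * t) := mul_nonneg (by positivity) (sub_nonneg.2 h1)
  have k1 : 0 ≤ (u x ^ 2 * t ^ 2) * (1 - X * t) := mul_nonneg (by positivity) (sub_nonneg.2 h1)
  have k3 : 0 ≤ (Q - S + κ * t * u x) ^ 2 := sq_nonneg _
  have k4 := mul_nonneg (mul_nonneg hκ0.le h0.le) hsq
  have k5 := mul_nonneg (mul_nonneg hκ0.le (show 0 ≤ a + 1 by linarith)) k2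
  have k6 := mul_nonneg (mul_nonneg hκ0.le (show 0 ≤ 4 * (a + 1) + a ^ 2 by positivity)) k1
  rw [hid]
  -- The difference of the two sides is exactly this sum of nonnegative terms: with $N=2a+4$ the
  -- leftover coefficient of $t^2u^2$ is a multiple of $a^2+2a-\kappa=0$.
  refine le_of_le_of_eq (add_nonneg (add_nonneg (add_nonneg k3
    (mul_nonneg (zero_le_two (α := ℝ)) k4)) (mul_nonneg (zero_le_two (α := ℝ)) k5))
    (mul_nonneg (zero_le_two (α := ℝ)) k6)) ?_
  have : κ * (t ^ 2 * u x ^ 2) * (a ^ 2 + 2 * a) = κ * (t ^ 2 * u x ^ 2) * κ := by rw [← hκ]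
  linear_combination -2 * this

/-- The Gaussian Rellich inequality for real functions. -/
theorem rellich_real (hN : 5 ≤ N) {u : Space N → ℝ} {p q : Fin N → Space N → ℝ}
    (hu : ∀ i, MemGaussianH1 i u (p i)) (hp : ∀ i, MemGaussianH1 i (p i) (q i)) {a κ : ℝ}
    (ha : a = ((N : ℝ) - 4) / 2) (hκ : κ = a ^ 2 + 2 * a) :
    Integrable (fun x => u x ^ 2 / ‖x‖ ^ 4) (gaussianMeasure N) ∧
    κ ^ 2 * ∫ x, u x ^ 2 / ‖x‖ ^ 4 ∂(gaussianMeasure N) ≤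
      (∫ x, (∑ i, q i x - ∑ i, x i * p i x) ^ 2 ∂(gaussianMeasure N)) +
        2 * κ * (a + 1) * ((∫ x, u x ^ 2 ∂(gaussianMeasure N)) +
          ∫ x, ∑ i, p i x ^ 2 ∂(gaussianMeasure N)) := by
  have hN' : (5 : ℝ) ≤ N := by exact_mod_cast hN
  have ha0 : 0 < a := by rw [ha]; linarith
  have hκ0 : 0 < κ := by rw [hκ]; positivity
  have : Nonempty (Fin N) := ⟨⟨0, by omega⟩⟩
  have hcu := (hu ⟨0, by omega⟩).memLp
  set B := ((∫ x, (∑ i, q i x - ∑ i, x i * p i x) ^ 2 ∂(gaussianMeasure N)) +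
        2 * κ * (a + 1) * ((∫ x, u x ^ 2 ∂(gaussianMeasure N)) +
          ∫ x, ∑ i, p i x ^ 2 ∂(gaussianMeasure N))) with hB
  have hεn : ∀ n : ℕ, (0 : ℝ) < 1 / ((n : ℝ) + 1) := fun n => by positivity
  have hi : ∀ n : ℕ, Integrable (fun x => regInv (1 / ((n : ℝ) + 1)) x ^ 2 * u x ^ 2)
      (gaussianMeasure N) := fun n =>
    integrable_mul_of_le (C := ((1 / ((n : ℝ) + 1))⁻¹ + 1) ^ 2) hcu.integrable_sq
      ((contDiff_regInv (hεn n)).continuous.pow 2) fun x => by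
        rw [abs_pow, abs_of_pos (regInv_pos (hεn n) x)]
        have := (regInv_pos (hεn n) x).le
        gcongr
        exact regInv_le (hεn n) x
  have h0 : ∀ᵐ x ∂(gaussianMeasure N), x ≠ 0 :=
    gaussianMeasure_absolutelyContinuous.ae_le (Measure.ae_ne volume 0)
  -- Fatou with $\varepsilon=1/(n+1)$; the bound is independent of $n$ once Hardy has replaced the
  -- lower-order term.
  have h := integrable_and_integral_le_of_tendsto (G := fun x => u x ^ 2 / ‖x‖ ^ 4)
    (B := B / κ ^ 2) hi (fun n x => by positivity) (fun n => ?_) ?_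
  · refine ⟨h.1, ?_⟩
    have := (le_div_iff₀ (by positivity)).1 h.2
    linarith
  · rw [le_div_iff₀ (by positivity), mul_comm]
    refine (integral_regInv_sq_le (hεn n) hN hu hp ha hκ).trans ?_
    rw [hB]
    gcongr
    exact integral_regInv_le (hεn n) hN hu
  · filter_upwards [h0] with x hx
    have hx' : (‖x‖ ^ 2 + 0 : ℝ) ≠ 0 := by simpa using hx
    have h1 := (((tendsto_one_div_add_atTop_nhds_zero_nat (𝕜 := ℝ)).const_add
      (‖x‖ ^ 2)).inv₀ hx').pow 2 |>.mul_const (u x ^ 2)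
    have e : ((‖x‖ ^ 2 + 0)⁻¹) ^ 2 * u x ^ 2 = u x ^ 2 / ‖x‖ ^ 4 := by
      rw [add_zero, ← inv_pow, div_eq_mul_inv]
      ring
    rw [e] at h1
    exact h1

/-! ### Passage from real to real- or complex-valued functions. -/

section Scalar
variable {𝕜 : Type*} [RCLike 𝕜]

theorem locallyIntegrable_clm_comp {u : Space N → 𝕜} (hu : LocallyIntegrable u) (L : 𝕜 →L[ℝ] ℝ) :
    LocallyIntegrable fun x => L (u x) := fun x =>
  let ⟨s, hs, h⟩ := hu x
  ⟨s, hs, L.integrable_comp h⟩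

theorem HasWeakPartial.clm_comp {i : Fin N} {u v : Space N → 𝕜} (h : HasWeakPartial i u v)
    (L : 𝕜 →L[ℝ] ℝ) : HasWeakPartial i (fun x => L (u x)) (fun x => L (v x)) := by
  refine ⟨locallyIntegrable_clm_comp h.1 L, locallyIntegrable_clm_comp h.2.1 L, fun φ hφ hc => ?_⟩
  have i1 : Integrable fun x => fderiv ℝ φ x (EuclideanSpace.single i 1) • u x :=
    h.1.integrable_smul_left_of_hasCompactSupport (continuous_fderiv_single hφ i)
      ((hc.fderiv ℝ).comp_left (g := fun L : Space N →L[ℝ] ℝ => L (EuclideanSpace.single i 1))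
        (by simp))
  have i2 : Integrable fun x => φ x • v x :=
    h.2.1.integrable_smul_left_of_hasCompactSupport hφ.continuous hc
  have := congrArg L (h.2.2 φ hφ hc)
  rw [map_neg, ← L.integral_comp_comm i1, ← L.integral_comp_comm i2] at this
  simpa only [map_smul] using this

theorem MemH2.memGaussianH1 {u : Space N → 𝕜} (h : MemH2 u) (L : 𝕜 →L[ℝ] ℝ) (i : Fin N) :
    MemGaussianH1 i (fun x => L (u x)) (fun x => L (weakPartial i u x)) :=
  ⟨(h.hasWeakPartial i).clm_comp L, L.comp_memLp' h.memLp, L.comp_memLp' (h.memLp_partial i)⟩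

theorem MemH2.memGaussianH1_partial {u : Space N → 𝕜} (h : MemH2 u) (L : 𝕜 →L[ℝ] ℝ) (i : Fin N) :
    MemGaussianH1 i (fun x => L (weakPartial i u x))
      (fun x => L (weakPartial i (weakPartial i u) x)) :=
  ⟨(h.hasWeakPartial₂ i i).clm_comp L, L.comp_memLp' (h.memLp_partial i),
    L.comp_memLp' (h.memLp_partial₂ i i)⟩

theorem clm_ornsteinUhlenbeck (u : Space N → 𝕜) (L : 𝕜 →L[ℝ] ℝ) (x : Space N) :
    L (ornsteinUhlenbeck u x) = ∑ i, L (weakPartial i (weakPartial i u) x)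
      - ∑ i, x i * L (weakPartial i u x) := by
  simp [ornsteinUhlenbeck, map_sub, map_sum]

/-- The second derivatives are in $L^2_\mu$ by assumption; the drift is there because each $D_iu$
has its own $D_i$-derivative in $L^2_\mu$, which pays for the factor $x_i$. -/
theorem MemH2.memLp_clm_ornsteinUhlenbeck {u : Space N → 𝕜} (h : MemH2 u) (L : 𝕜 →L[ℝ] ℝ) :
    MemLp (fun x => L (ornsteinUhlenbeck u x)) 2 (gaussianMeasure N) := by
  simp only [clm_ornsteinUhlenbeck]
  exact (memLp_finsetSum _ fun i _ => (h.memGaussianH1_partial L i).memLp').sub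
    (memLp_finsetSum _ fun i _ => (h.memGaussianH1_partial L i).memLp_coord_mul)

theorem MemH2.memLp_ornsteinUhlenbeck {u : Space N → 𝕜} (h : MemH2 u) :
    MemLp (ornsteinUhlenbeck u) 2 (gaussianMeasure N) :=
  memLp_re_im_iff.1 ⟨h.memLp_clm_ornsteinUhlenbeck RCLike.reCLM,
    h.memLp_clm_ornsteinUhlenbeck RCLike.imCLM⟩

theorem norm_sq_eq_re_sq_add_im_sq (z : 𝕜) :
    ‖z‖ ^ 2 = RCLike.reCLM z ^ 2 + RCLike.imCLM z ^ 2 := by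
  rw [RCLike.norm_sq_eq_def, RCLike.reCLM_apply, RCLike.imCLM_apply]
  ring

theorem integral_norm_sq {f : Space N → 𝕜} (hf : MemLp f 2 (gaussianMeasure N)) :
    ∫ x, ‖f x‖ ^ 2 ∂(gaussianMeasure N) = (∫ x, RCLike.reCLM (f x) ^ 2 ∂(gaussianMeasure N))
      + ∫ x, RCLike.imCLM (f x) ^ 2 ∂(gaussianMeasure N) := by
  have h : ∀ L : 𝕜 →L[ℝ] ℝ, Integrable (fun x => L (f x) ^ 2) (gaussianMeasure N) := fun L =>
    (L.comp_memLp' hf).integrable_sq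
  rw [← integral_add (h _) (h _)]
  simp only [norm_sq_eq_re_sq_add_im_sq]

theorem hardyConst_sub_one (N : ℕ) :
    hardyConst N - 1 = (((N : ℝ) - 4) / 2) ^ 2 + 2 * (((N : ℝ) - 4) / 2) := by
  unfold hardyConst; ring

/-- Real-linear functionals commute with weak derivatives and with $L$, and every term is a sum of
squares of real and imaginary parts, so the two real inequalities add up with the same constants. -/
theorem MemH2.rellich (hN : 5 ≤ N) {u : Space N → 𝕜} (h : MemH2 u) :
    Integrable (fun x => ‖u x‖ ^ 2 / ‖x‖ ^ 4) (gaussianMeasure N) ∧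
    (hardyConst N - 1) ^ 2 * rellichIntegral u ≤
      (∫ x, ‖ornsteinUhlenbeck u x‖ ^ 2 ∂(gaussianMeasure N)) +
        2 * (hardyConst N - 1) * (((N : ℝ) - 4) / 2 + 1) * h1NormSq u := by
  have key := fun L : 𝕜 →L[ℝ] ℝ => rellich_real hN (fun i => h.memGaussianH1 L i)
    (fun i => h.memGaussianH1_partial L i) rfl (hardyConst_sub_one N)
  obtain ⟨i1, l1⟩ := key RCLike.reCLM
  obtain ⟨i2, l2⟩ := key RCLike.imCLM
  have e : (fun x => ‖u x‖ ^ 2 / ‖x‖ ^ 4) = fun x =>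
      RCLike.reCLM (u x) ^ 2 / ‖x‖ ^ 4 + RCLike.imCLM (u x) ^ 2 / ‖x‖ ^ 4 := by
    funext x
    rw [norm_sq_eq_re_sq_add_im_sq, add_div]
  refine ⟨e ▸ i1.add i2, ?_⟩
  have hg : ∀ L : 𝕜 →L[ℝ] ℝ,
      Integrable (fun x => ∑ i, L (weakPartial i u x) ^ 2) (gaussianMeasure N) := fun L =>
    integrable_finsetSum _ fun i _ => (h.memGaussianH1 L i).memLp'.integrable_sq
  have eg : ∫ x, gradSq u x ∂(gaussianMeasure N) =
      (∫ x, ∑ i, RCLike.reCLM (weakPartial i u x) ^ 2 ∂(gaussianMeasure N)) +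
      ∫ x, ∑ i, RCLike.imCLM (weakPartial i u x) ^ 2 ∂(gaussianMeasure N) := by
    rw [← integral_add (hg _) (hg _)]
    simp only [gradSq, norm_sq_eq_re_sq_add_im_sq, Finset.sum_add_distrib]
  rw [rellichIntegral, e, integral_add i1 i2, integral_norm_sq h.memLp_ornsteinUhlenbeck,
    h1NormSq, integral_norm_sq h.memLp, eg]
  simp only [clm_ornsteinUhlenbeck]
  linarith

end Scalar

/-! ### Classical derivatives as weak derivatives, and smooth members of $H^2_\mu$. -/

section SmoothFunctions
variable {𝕜 : Type*} [RCLike 𝕜]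

theorem hasCompactSupport_fderiv_apply {φ : Space N → ℝ} (hc : HasCompactSupport φ) (e : Space N) :
    HasCompactSupport fun x => fderiv ℝ φ x e :=
  (hc.fderiv ℝ).comp_left (g := fun L : Space N →L[ℝ] ℝ => L e) (by simp)

theorem hasWeakPartial_ofReal {v v' : Space N → ℝ} (i : Fin N) (hv : ContDiff ℝ ∞ v)
    (h : ∀ x, fderiv ℝ v x (EuclideanSpace.single i 1) = v' x) :
    HasWeakPartial i (fun x => (v x : 𝕜)) (fun x => (v' x : 𝕜)) := by
  have hv' : Continuous v' := by
    have := continuous_fderiv_single hv i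
    simpa only [h] using this
  have c0 : Continuous fun x => (v x : 𝕜) := RCLike.continuous_ofReal.comp hv.continuous
  have c1 : Continuous fun x => (v' x : 𝕜) := RCLike.continuous_ofReal.comp hv'
  have hd : ∀ x, HasFDerivAt (fun x => (v x : 𝕜))
      ((RCLike.ofRealCLM : ℝ →L[ℝ] 𝕜).comp (fderiv ℝ v x)) x := fun x =>
    (RCLike.ofRealCLM : ℝ →L[ℝ] 𝕜).hasFDerivAt.comp x
      (hv.differentiable (by simp) x).hasFDerivAt
  have hd' : ∀ x, fderiv ℝ (fun x => (v x : 𝕜)) x (EuclideanSpace.single i 1) = (v' x : 𝕜) := by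
    intro x
    rw [(hd x).fderiv, ← h x]
    simp
  refine ⟨c0.locallyIntegrable, c1.locallyIntegrable, fun φ hφ hc => ?_⟩
  have hibp := integral_smul_fderiv_eq_neg_fderiv_smul_of_integrable (μ := volume) (f := φ)
    (g := fun x => (v x : 𝕜)) (v := EuclideanSpace.single i 1)
    (c0.locallyIntegrable.integrable_smul_left_of_hasCompactSupport (continuous_fderiv_single hφ i)
      (hasCompactSupport_fderiv_apply hc _))
    (by
      simp only [hd']
      exact c1.locallyIntegrable.integrable_smul_left_of_hasCompactSupport hφ.continuous hc)
    (c0.locallyIntegrable.integrable_smul_left_of_hasCompactSupport hφ.continuous hc)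
    (fun x _ => hφ.differentiable (by simp) x) (fun x _ => (hd x).differentiableAt)
  simp only [hd'] at hibp
  rw [hibp, neg_neg]

theorem HasWeakPartial.ae_eq {i : Fin N} {u v w : Space N → 𝕜} (hv : HasWeakPartial i u v)
    (hw : HasWeakPartial i u w) : v =ᵐ[volume] w :=
  ae_eq_of_integral_contDiff_smul_eq hv.2.1 hw.2.1 fun φ hφ hc =>
    neg_injective ((hv.2.2 φ hφ hc).symm.trans (hw.2.2 φ hφ hc))

theorem HasWeakPartial.congr_left {i : Fin N} {u u' v : Space N → 𝕜} (h : HasWeakPartial i u v)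
    (hu : u' =ᵐ[volume] u) : HasWeakPartial i u' v := by
  refine ⟨(locallyIntegrable_congr hu).2 h.1, h.2.1, fun φ hφ hc => ?_⟩
  rw [← h.2.2 φ hφ hc]
  refine integral_congr_ae ?_
  filter_upwards [hu] with x hx
  rw [hx]

theorem HasWeakPartial.weakPartial {i : Fin N} {u v : Space N → 𝕜} (h : HasWeakPartial i u v) :
    HasWeakPartial i u (weakPartial i u) := by
  have h' : ∃ v, HasWeakPartial i u v := ⟨v, h⟩
  rw [GaussianRellich.weakPartial, dif_pos h']
  exact h'.choose_spec

theorem HasWeakPartial.weakPartial_ae_eq {i : Fin N} {u v : Space N → 𝕜}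
    (h : HasWeakPartial i u v) : GaussianRellich.weakPartial i u =ᵐ[volume] v :=
  h.weakPartial.ae_eq h

theorem memLp_ofReal_of_bounded {v : Space N → ℝ} (hv : Continuous v) {K : ℝ}
    (hK : ∀ x, |v x| ≤ K) : MemLp (fun x => (v x : 𝕜)) 2 (gaussianMeasure N) :=
  MemLp.of_bound (RCLike.continuous_ofReal.comp hv).aestronglyMeasurable K
    (ae_of_all _ fun x => by rw [RCLike.norm_ofReal]; exact hK x)

/-- A smooth function that is bounded with its first and second derivatives lies in `H²_μ`, and
its weak derivatives are the classical ones. -/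
theorem memH2_ofReal {v : Space N → ℝ} {v₁ : Fin N → Space N → ℝ}
    {v₂ : Fin N → Fin N → Space N → ℝ} (hv : ContDiff ℝ ∞ v) (hv₁ : ∀ i, ContDiff ℝ ∞ (v₁ i))
    (h₁ : ∀ i x, fderiv ℝ v x (EuclideanSpace.single i 1) = v₁ i x)
    (h₂ : ∀ i j x, fderiv ℝ (v₁ i) x (EuclideanSpace.single j 1) = v₂ i j x) {K : ℝ}
    (b : ∀ x, |v x| ≤ K) (b₁ : ∀ i x, |v₁ i x| ≤ K) (b₂ : ∀ i j x, |v₂ i j x| ≤ K) :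
    MemH2 (fun x => (v x : 𝕜)) ∧
    (∀ i, weakPartial i (fun x => (v x : 𝕜)) =ᵐ[volume] fun x => (v₁ i x : 𝕜)) ∧
    ∀ i j, weakPartial j (weakPartial i (fun x => (v x : 𝕜))) =ᵐ[volume]
      fun x => (v₂ i j x : 𝕜) := by
  have w₁ : ∀ i, HasWeakPartial i (fun x => (v x : 𝕜)) (fun x => (v₁ i x : 𝕜)) := fun i =>
    hasWeakPartial_ofReal i hv (h₁ i)
  have e₁ := fun i => (w₁ i).weakPartial_ae_eq
  have w₂ : ∀ i j, HasWeakPartial j (weakPartial i (fun x => (v x : 𝕜)))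
      (fun x => (v₂ i j x : 𝕜)) := fun i j =>
    -- The first weak derivative is a chosen representative, equal to the classical one only almost
    -- everywhere; that suffices for differentiating again.
    (hasWeakPartial_ofReal j (hv₁ i) (h₂ i j)).congr_left (e₁ i)
  have e₂ := fun i j => (w₂ i j).weakPartial_ae_eq
  have c₂ : ∀ i j, Continuous (v₂ i j) := fun i j => by
    have := continuous_fderiv_single (hv₁ i) j
    simpa only [h₂] using this
  refine ⟨⟨memLp_ofReal_of_bounded hv.continuous b, fun i => (w₁ i).weakPartial,
    fun i => ?_, fun i j => (w₂ i j).weakPartial, fun i j => ?_⟩, e₁, e₂⟩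
  · exact (memLp_ofReal_of_bounded (hv₁ i).continuous (b₁ i)).ae_eq
      (gaussianMeasure_absolutelyContinuous.ae_eq (e₁ i)).symm
  · exact (memLp_ofReal_of_bounded (c₂ i j) (b₂ i j)).ae_eq
      (gaussianMeasure_absolutelyContinuous.ae_eq (e₂ i j)).symm

end SmoothFunctions

/-! ### Real powers of the regularised weight and their Gaussian integrals. -/

theorem contDiff_regInv_rpow {ε : ℝ} (hε : 0 < ε) (α : ℝ) :
    ContDiff ℝ ∞ fun x : Space N => regInv ε x ^ α :=
  (contDiff_regInv hε).rpow_const_of_ne fun x => (regInv_pos hε x).ne'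

theorem continuous_regInv_rpow {ε : ℝ} (hε : 0 < ε) (α : ℝ) :
    Continuous fun x : Space N => regInv ε x ^ α :=
  (contDiff_regInv_rpow hε α).continuous

theorem hasFDerivAt_regInv_rpow {ε : ℝ} (hε : 0 < ε) (α : ℝ) (x : Space N) :
    HasFDerivAt (fun x : Space N => regInv ε x ^ α)
      ((α * regInv ε x ^ (α - 1)) • fderiv ℝ (regInv ε) x) x :=
  ((contDiff_regInv hε).differentiable (by simp) x).hasFDerivAt.rpow_const
    (Or.inl (regInv_pos hε x).ne')

theorem fderiv_regInv_rpow {ε : ℝ} (hε : 0 < ε) (α : ℝ) (x : Space N) (i : Fin N) :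
    fderiv ℝ (fun x : Space N => regInv ε x ^ α) x (EuclideanSpace.single i 1)
      = -2 * α * (x i * regInv ε x ^ (α + 1)) := by
  have h0 := regInv_pos hε x
  rw [(hasFDerivAt_regInv_rpow hε α x).fderiv]
  simp only [_root_.smul_apply, smul_eq_mul, fderiv_regInv hε]
  rw [Real.rpow_sub_one h0.ne', Real.rpow_add_one h0.ne']
  field_simp

theorem fderiv_coord_mul_regInv_rpow {ε : ℝ} (hε : 0 < ε) (α : ℝ) (x : Space N) (i j : Fin N) :
    fderiv ℝ (fun x : Space N => x i * regInv ε x ^ α) x (EuclideanSpace.single j 1)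
      = (if i = j then 1 else 0) * regInv ε x ^ α
        - 2 * α * ((x j * regInv ε x) * (x i * regInv ε x ^ α)) := by
  have h0 := regInv_pos hε x
  have h2 : HasFDerivAt (fun x : Space N => x i * regInv ε x ^ α) _ x :=
    (hasFDerivAt_coord x i).mul (hasFDerivAt_regInv_rpow hε α x)
  rw [h2.fderiv]
  simp only [_root_.add_apply, _root_.smul_apply, smul_eq_mul, fderiv_regInv hε]
  rw [Real.rpow_sub_one h0.ne']
  simp
  field_simp
  ring

theorem abs_regInv_rpow_le {ε : ℝ} (hε : 0 < ε) {α : ℝ} (hα : 0 ≤ α) (x : Space N) :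
    |regInv ε x ^ α| ≤ (ε⁻¹ + 1) ^ α := by
  have h0 := regInv_pos hε x
  rw [abs_of_nonneg (by positivity)]
  exact Real.rpow_le_rpow h0.le (regInv_le hε x) hα

theorem abs_coord_mul_regInv_rpow_le {ε : ℝ} (hε : 0 < ε) {α : ℝ} (hα : 1 ≤ α) (x : Space N)
    (i : Fin N) : |x i * regInv ε x ^ α| ≤ (ε⁻¹ + 1) ^ α := by
  have h0 := regInv_pos hε x
  have hM : 0 < ε⁻¹ + 1 := by positivity
  have e : ∀ y : ℝ, 0 < y → y ^ α = y * y ^ (α - 1) := fun y hy => by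
    rw [Real.rpow_sub_one hy.ne']
    field_simp
  rw [e _ h0, e _ hM, ← mul_assoc, abs_mul]
  exact mul_le_mul (abs_coord_mul_regInv_le hε x i) (abs_regInv_rpow_le hε (by linarith) x)
    (abs_nonneg _) hM.le

theorem abs_fderiv_coord_mul_regInv_rpow_le {ε : ℝ} (hε : 0 < ε) {α : ℝ} (hα : 1 ≤ α)
    (x : Space N) (i j : Fin N) :
    |(if i = j then 1 else 0) * regInv ε x ^ α
      - 2 * α * ((x j * regInv ε x) * (x i * regInv ε x ^ α))|
      ≤ (ε⁻¹ + 1) ^ α + 2 * α * ((ε⁻¹ + 1) * (ε⁻¹ + 1) ^ α) := by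
  have hM : 0 < ε⁻¹ + 1 := by positivity
  refine (abs_sub _ _).trans (add_le_add ?_ ?_)
  · rw [abs_mul]
    refine (mul_le_of_le_one_left (abs_nonneg _) ?_).trans (abs_regInv_rpow_le hε (by linarith) x)
    split_ifs <;> simp
  · rw [abs_mul, abs_of_nonneg (by linarith), abs_mul (x j * _)]
    gcongr
    exacts [abs_coord_mul_regInv_le hε x j, abs_coord_mul_regInv_rpow_le hε hα x i]

theorem memGaussianH1_one (i : Fin N) : MemGaussianH1 i (fun _ => 1) (fun _ => 0) where
  weak := by
    have := hasWeakPartial_ofReal (𝕜 := ℝ) (N := N) i (v := fun _ => 1) (v' := fun _ => 0)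
      contDiff_const (by simp)
    simpa using this
  memLp := memLp_const 1
  memLp' := memLp_const 0

/-- The moment estimate applied to the constant function $1$ yields the Gaussian second moments. -/
theorem memLp_coord (i : Fin N) : MemLp (fun x => x i) 2 (gaussianMeasure N) := by
  simpa using (memGaussianH1_one i).memLp_coord_mul

theorem integrable_normSq : Integrable (fun x => ‖x‖ ^ 2) (gaussianMeasure N) := by
  simp only [EuclideanSpace.real_norm_sq_eq]
  exact integrable_finsetSum _ fun i _ => (memLp_coord i).integrable_sq

theorem integrable_regInv_rpow {ε : ℝ} (hε : 0 < ε) {α : ℝ} (hα : 0 ≤ α) :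
    Integrable (fun x => regInv ε x ^ α) (gaussianMeasure N) :=
  Integrable.of_bound (continuous_regInv_rpow hε α).aestronglyMeasurable _
    (ae_of_all _ fun x => abs_regInv_rpow_le hε hα x)

theorem integrable_normSq_mul_regInv_rpow {ε : ℝ} (hε : 0 < ε) {α : ℝ} (hα : 0 ≤ α) :
    Integrable (fun x => ‖x‖ ^ 2 * regInv ε x ^ α) (gaussianMeasure N) := by
  simpa only [mul_comm] using integrable_mul_of_le integrable_normSq
    (continuous_regInv_rpow hε α) (abs_regInv_rpow_le hε hα)

/-- The Gaussian divergence theorem for the field `x ↦ (|x|² + ε)^{-α} x`. -/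
theorem integral_div_regInv_rpow {ε : ℝ} (hε : 0 < ε) {α : ℝ} (hα : 1 ≤ α) :
    ∫ x : Space N, (N - 2 * α * (1 - ε * regInv ε x)) * regInv ε x ^ α ∂(gaussianMeasure N)
      = ∫ x : Space N, ‖x‖ ^ 2 * regInv ε x ^ α ∂(gaussianMeasure N) := by
  have hM : 0 < ε⁻¹ + 1 := by positivity
  have hb : ∀ (x : Space N) (i : Fin N),
      |1 * regInv ε x ^ α - 2 * α * ((x i * regInv ε x) * (x i * regInv ε x ^ α))|
      ≤ (ε⁻¹ + 1) ^ α + 2 * α * ((ε⁻¹ + 1) * (ε⁻¹ + 1) ^ α) := fun x i => by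
    simpa using abs_fderiv_coord_mul_regInv_rpow_le hε hα x i i
  have h := fun i : Fin N => (memGaussianH1_one i).integral_mul (memGaussianH1_one i)
    ((contDiff_coord i).mul (contDiff_regInv_rpow hε α))
    (ψ' := fun x => 1 * regInv ε x ^ α - 2 * α * ((x i * regInv ε x) * (x i * regInv ε x ^ α)))
    (fun x => by simpa using fderiv_coord_mul_regInv_rpow hε α x i i)
    (K := (ε⁻¹ + 1) ^ α + 2 * α * ((ε⁻¹ + 1) * (ε⁻¹ + 1) ^ α))
    (fun x => (abs_coord_mul_regInv_rpow_le hε hα x i).trans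
      (le_add_of_nonneg_right (mul_nonneg (by linarith) (by positivity)))) (hb · i)
  simp only [mul_one, mul_zero, add_zero, integral_zero, neg_zero] at h
  have i1 : ∀ i : Fin N, Integrable (fun x : Space N => 1 * regInv ε x ^ α
      - 2 * α * ((x i * regInv ε x) * (x i * regInv ε x ^ α))) (gaussianMeasure N) := fun i => by
    refine Integrable.of_bound (Continuous.aestronglyMeasurable ?_) _ (ae_of_all _ (hb · i))
    have c1 := continuous_regInv_rpow (N := N) hε α
    have c2 : Continuous (regInv ε : Space N → ℝ) := (contDiff_regInv hε).continuous
    exact (c1.const_mul 1).sub ((((continuous_coord i).mul c2).mul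
      ((continuous_coord i).mul c1)).const_mul _)
  have i2 : ∀ i : Fin N, Integrable (fun x : Space N => x i * (x i * regInv ε x ^ α))
      (gaussianMeasure N) := fun i => by
    refine (integrable_mul_of_le (memLp_coord i).integrable_sq (continuous_regInv_rpow hε α)
      (abs_regInv_rpow_le hε (by linarith))).congr (ae_of_all _ fun x => ?_)
    dsimp only; ring
  have h' : ∀ i : Fin N, ∫ x : Space N, (1 * regInv ε x ^ α
      - 2 * α * ((x i * regInv ε x) * (x i * regInv ε x ^ α))) ∂(gaussianMeasure N)
      = ∫ x : Space N, x i * (x i * regInv ε x ^ α) ∂(gaussianMeasure N) := fun i => by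
    rw [← sub_eq_zero, ← integral_sub (i1 i) (i2 i)]
    exact h i
  have hs := Finset.sum_congr rfl fun (i : Fin N) (_ : i ∈ Finset.univ) => h' i
  rw [← integral_finsetSum _ fun i _ => i1 i, ← integral_finsetSum _ fun i _ => i2 i] at hs
  have hX : ∀ x : Space N, ‖x‖ ^ 2 = ∑ i, x i ^ 2 := EuclideanSpace.real_norm_sq_eq
  refine Eq.trans (integral_congr_ae (ae_of_all _ fun x => ?_)) (hs.trans
    (integral_congr_ae (ae_of_all _ fun x => ?_)))
  · have h0 := regInv_pos hε x
    have h1 : 1 - ε * regInv ε x = ‖x‖ ^ 2 * regInv ε x := by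
      have : (‖x‖ ^ 2 + ε) * regInv ε x = 1 := mul_inv_cancel₀ (by positivity)
      linarith
    have hNs : (N : ℝ) = ∑ i : Fin N, 1 := by simp
    dsimp only
    rw [h1, hX, hNs]
    simp only [Finset.mul_sum, Finset.sum_mul, ← Finset.sum_sub_distrib]
    refine Finset.sum_congr rfl fun i _ => ?_
    ring
  · dsimp only
    rw [hX, Finset.sum_mul]
    refine Finset.sum_congr rfl fun i _ => ?_
    ring

theorem mul_regInv_le_one {ε : ℝ} (hε : 0 < ε) (x : Space N) : ε * regInv ε x ≤ 1 := by
  unfold regInv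
  rw [← div_eq_mul_inv, div_le_one (by positivity)]
  nlinarith [sq_nonneg ‖x‖]

/-- The error terms of the optimising family are bounded uniformly in `ε`. -/
theorem exists_uniform_bound (hN : 5 ≤ N) : ∃ B : ℝ, ∀ ε : ℝ, 0 < ε →
    ∫ x : Space N, regInv ε x ^ ((N : ℝ) / 2 - 1) ∂(gaussianMeasure N) ≤ B ∧
    ∫ x : Space N, regInv ε x ^ ((N : ℝ) / 2 - 2) ∂(gaussianMeasure N) ≤ B ∧
    ∫ x : Space N, (ε * regInv ε x) * regInv ε x ^ ((N : ℝ) / 2) ∂(gaussianMeasure N) ≤ B := by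
  have hN' : (5 : ℝ) ≤ N := by exact_mod_cast hN
  set m := ∫ x : Space N, ‖x‖ ^ 2 ∂(gaussianMeasure N)
  have hm : 0 ≤ m := integral_nonneg fun x => sq_nonneg _
  set v := ∫ _ : Space N, (1 : ℝ) ∂(gaussianMeasure N)
  have hv : 0 ≤ v := integral_nonneg fun x => zero_le_one
  refine ⟨v + m, fun ε hε => ?_⟩
  have hp := fun x : Space N => regInv_pos hε x
  have iN1 : Integrable (fun x : Space N => regInv ε x ^ ((N : ℝ) / 2 - 1)) (gaussianMeasure N) :=
    integrable_regInv_rpow hε (by linarith)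
  have h1 : ∫ x : Space N, regInv ε x ^ ((N : ℝ) / 2 - 1) ∂(gaussianMeasure N) ≤ m := by
    -- At $\alpha=N/2-1$ the divergence factor is at least $2$, while $|x|^2t^\alpha\le
    -- t^\alpha+|x|^2$ (split at $|x|=1$). Hence $2\int t^\alpha\le\int t^\alpha+m$, and one copy is
    -- absorbed.
    have hd := integral_div_regInv_rpow (N := N) hε (α := (N : ℝ) / 2 - 1) (by linarith)
    have l1 : ∫ x : Space N, 2 * regInv ε x ^ ((N : ℝ) / 2 - 1) ∂(gaussianMeasure N) ≤
        ∫ x : Space N, (N - 2 * ((N : ℝ) / 2 - 1) * (1 - ε * regInv ε x)) *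
          regInv ε x ^ ((N : ℝ) / 2 - 1) ∂(gaussianMeasure N) := by
      refine integral_mono (iN1.const_mul 2) (integrable_mul_of_le (C := 2 * N) iN1
        (continuous_const.sub (continuous_const.mul (continuous_const.sub
          (continuous_const.mul (contDiff_regInv hε).continuous)))) fun x => ?_) fun x => ?_
      · have a1 := mul_regInv_le_one hε x
        have a2 := mul_pos hε (hp x)
        rw [abs_le]
        constructor <;> nlinarith
      · dsimp only
        have a2 := mul_pos hε (hp x)
        have a3 := Real.rpow_pos_of_pos (hp x) ((N : ℝ) / 2 - 1)
        gcongr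
        nlinarith
    have l2 : ∫ x : Space N, ‖x‖ ^ 2 * regInv ε x ^ ((N : ℝ) / 2 - 1) ∂(gaussianMeasure N) ≤
        ∫ x : Space N, (regInv ε x ^ ((N : ℝ) / 2 - 1) + ‖x‖ ^ 2) ∂(gaussianMeasure N) := by
      refine integral_mono (integrable_normSq_mul_regInv_rpow hε (by linarith))
        (iN1.add integrable_normSq) fun x => ?_
      have a3 := Real.rpow_pos_of_pos (hp x) ((N : ℝ) / 2 - 1)
      dsimp only
      rcases le_total (‖x‖ ^ 2) 1 with hx | hx
      · nlinarith [sq_nonneg ‖x‖]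
      · have : regInv ε x ≤ 1 := by
          have := normSq_mul_regInv_le hε x
          nlinarith [hp x]
        have := Real.rpow_le_one (hp x).le this (show 0 ≤ (N : ℝ) / 2 - 1 by linarith)
        nlinarith
    rw [integral_add iN1 integrable_normSq] at l2
    rw [integral_const_mul] at l1
    linarith
  refine ⟨by linarith, ?_, ?_⟩
  · have l3 : ∫ x : Space N, regInv ε x ^ ((N : ℝ) / 2 - 2) ∂(gaussianMeasure N) ≤
        ∫ x : Space N, ((1 : ℝ) + regInv ε x ^ ((N : ℝ) / 2 - 1)) ∂(gaussianMeasure N) := by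
      refine integral_mono (integrable_regInv_rpow hε (by linarith))
        ((integrable_const 1).add iN1) fun x => ?_
      have a3 := Real.rpow_pos_of_pos (hp x) ((N : ℝ) / 2 - 1)
      dsimp only
      rcases le_total (regInv ε x) 1 with hx | hx
      · have := Real.rpow_le_one (hp x).le hx (show 0 ≤ (N : ℝ) / 2 - 2 by linarith)
        linarith
      · have := Real.rpow_le_rpow_of_exponent_le hx
          (show (N : ℝ) / 2 - 2 ≤ (N : ℝ) / 2 - 1 by linarith)
        linarith
    rw [integral_add (integrable_const 1) iN1] at l3
    linarith
  -- At the critical $\alpha=N/2$ the divergence factor collapses to $N\varepsilon t$, so the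
  -- identity evaluates precisely the required error term.
  · have hd := integral_div_regInv_rpow (N := N) hε (α := (N : ℝ) / 2) (by linarith)
    have e : ∀ x : Space N, (N - 2 * ((N : ℝ) / 2) * (1 - ε * regInv ε x)) *
        regInv ε x ^ ((N : ℝ) / 2) = N * ((ε * regInv ε x) * regInv ε x ^ ((N : ℝ) / 2)) :=
      fun x => by ring
    simp only [e] at hd
    rw [integral_const_mul] at hd
    have l4 : ∫ x : Space N, ‖x‖ ^ 2 * regInv ε x ^ ((N : ℝ) / 2) ∂(gaussianMeasure N) ≤
        ∫ x : Space N, regInv ε x ^ ((N : ℝ) / 2 - 1) ∂(gaussianMeasure N) := by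
      refine integral_mono (integrable_normSq_mul_regInv_rpow hε (by linarith)) iN1 fun x => ?_
      dsimp only
      rw [show (N : ℝ) / 2 = (N : ℝ) / 2 - 1 + 1 by ring, Real.rpow_add_one (hp x).ne',
        add_sub_cancel_right]
      have a3 := Real.rpow_pos_of_pos (hp x) ((N : ℝ) / 2 - 1)
      nlinarith [normSq_mul_regInv_le hε x]
    have h0 : 0 ≤ ∫ x : Space N, (ε * regInv ε x) * regInv ε x ^ ((N : ℝ) / 2)
        ∂(gaussianMeasure N) := integral_nonneg fun x => by have := hp x; positivity
    nlinarith

/-- Near the origin $\mu$ is comparable to Lebesgue measure, and polar coordinates turn the function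
into $r^{-N}r^{N-1}=r^{-1}$ on $(0,1)$. -/
theorem not_integrable_norm_rpow_neg (hN : 1 ≤ N) :
    ¬ Integrable (fun x : Space N => ‖x‖ ^ (-(N : ℝ))) (gaussianMeasure N) := by
  intro h
  obtain ⟨c, hc, hle⟩ := volume_restrict_closedBall_le (N := N) 1
  have h1 : IntegrableOn (fun x : Space N => ‖x‖ ^ (-(N : ℝ))) (ball 0 1) :=
    (h.of_measure_le_smul hc hle).mono_measure (Measure.restrict_mono ball_subset_closedBall le_rfl)
  have : Nonempty (Fin N) := ⟨⟨0, hN⟩⟩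
  rw [integrableOn_fun_norm_addHaar (μ := volume) (f := fun y : ℝ => y ^ (-(N : ℝ)))] at h1
  have h2 : IntegrableOn (fun y : ℝ => y ^ (-1 : ℝ)) (Set.Ioo 0 1) := by
    refine h1.congr_fun (fun y hy => ?_) measurableSet_Ioo
    have hy0 : 0 < y := hy.1
    simp only [finrank_euclideanSpace, Fintype.card_fin, smul_eq_mul]
    rw [← Real.rpow_natCast, ← Real.rpow_add hy0]
    congr 1
    push_cast [hN]
    ring
  rw [intervalIntegral.integrableOn_Ioo_rpow_iff one_pos] at h2
  exact lt_irrefl _ h2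

/-- A uniform bound would pass to the limit $\varepsilon\to0$ by Fatou and make $|x|^{-N}$
integrable. -/
theorem not_bounded_integral_regInv_rpow (hN : 1 ≤ N) :
    ¬ ∃ B : ℝ, ∀ ε : ℝ, 0 < ε →
      ∫ x : Space N, regInv ε x ^ ((N : ℝ) / 2) ∂(gaussianMeasure N) ≤ B := by
  rintro ⟨B, hB⟩
  have hεn : ∀ n : ℕ, (0 : ℝ) < 1 / ((n : ℝ) + 1) := fun n => by positivity
  have : Nonempty (Fin N) := ⟨⟨0, hN⟩⟩
  have h0 : ∀ᵐ x ∂(gaussianMeasure N), x ≠ 0 :=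
    gaussianMeasure_absolutelyContinuous.ae_le (Measure.ae_ne volume 0)
  refine not_integrable_norm_rpow_neg hN (integrable_and_integral_le_of_tendsto (B := B)
    (F := fun n x => regInv (1 / ((n : ℝ) + 1)) x ^ ((N : ℝ) / 2))
    (fun n => integrable_regInv_rpow (hεn n) (by positivity))
    (fun n x => (Real.rpow_pos_of_pos (regInv_pos (hεn n) x) _).le) (fun n => hB _ (hεn n)) ?_).1
  filter_upwards [h0] with x hx
  have hx0 : 0 < ‖x‖ := norm_pos_iff.2 hx
  have hx' : (‖x‖ ^ 2 + 0 : ℝ) ≠ 0 := by simpa using hx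
  have h1 := (((tendsto_one_div_add_atTop_nhds_zero_nat (𝕜 := ℝ)).const_add
    (‖x‖ ^ 2)).inv₀ hx').rpow_const (p := (N : ℝ) / 2) (Or.inr (by positivity))
  have e : ((‖x‖ ^ 2 + 0)⁻¹) ^ ((N : ℝ) / 2) = ‖x‖ ^ (-(N : ℝ)) := by
    rw [add_zero, Real.inv_rpow (by positivity), ← Real.rpow_natCast, ← Real.rpow_mul hx0.le,
      ← Real.rpow_neg hx0.le]
    congr 1
    push_cast
    ring
  rw [e] at h1
  exact h1

/-! ### The optimising family and the best constant. -/

section Sharpness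
variable {𝕜 : Type*} [RCLike 𝕜]

/-- The functions `(|x|² + ε)^{-γ}` belong to `H²_μ`, with the classical derivatives. -/
theorem memH2_regInv_rpow {ε : ℝ} (hε : 0 < ε) {γ : ℝ} (hγ : 0 ≤ γ) :
    MemH2 (fun x : Space N => ((regInv ε x ^ γ : ℝ) : 𝕜)) ∧
    (∀ i, weakPartial i (fun x : Space N => ((regInv ε x ^ γ : ℝ) : 𝕜)) =ᵐ[volume]
      fun x => ((-2 * γ * (x i * regInv ε x ^ (γ + 1)) : ℝ) : 𝕜)) ∧
    ∀ i j, weakPartial j (weakPartial i (fun x : Space N => ((regInv ε x ^ γ : ℝ) : 𝕜)))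
      =ᵐ[volume] fun x => ((-2 * γ * ((if i = j then 1 else 0) * regInv ε x ^ (γ + 1)
        - 2 * (γ + 1) * ((x j * regInv ε x) * (x i * regInv ε x ^ (γ + 1)))) : ℝ) : 𝕜) := by
  have hM : 0 < ε⁻¹ + 1 := by positivity
  have hM1 : 1 ≤ γ + 1 := by linarith
  have c1 : ∀ i : Fin N, ContDiff ℝ ∞ fun x : Space N => x i * regInv ε x ^ (γ + 1) := fun i =>
    (contDiff_coord i).mul (contDiff_regInv_rpow hε (γ + 1))
  set K₀ := (ε⁻¹ + 1) ^ γ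
  set K₁ := 2 * γ * (ε⁻¹ + 1) ^ (γ + 1)
  set K₂ := 2 * γ * ((ε⁻¹ + 1) ^ (γ + 1)
    + 2 * (γ + 1) * ((ε⁻¹ + 1) * (ε⁻¹ + 1) ^ (γ + 1)))
  have k0 : 0 ≤ K₀ := by positivity
  have k1 : 0 ≤ K₁ := by positivity
  have k2 : 0 ≤ K₂ := by positivity
  have hneg : ∀ y z : ℝ, |y| ≤ z → |-2 * γ * y| ≤ 2 * γ * z := fun y z h => by
    rw [abs_mul, abs_mul, abs_of_nonneg hγ]
    simp only [abs_neg, Nat.abs_ofNat]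
    gcongr
  refine memH2_ofReal (K := K₀ + K₁ + K₂) (contDiff_regInv_rpow hε γ)
    (fun i => contDiff_const.mul (c1 i)) (fun i x => fderiv_regInv_rpow hε γ x i)
    (fun i j x => ?_) (fun x => ?_) (fun i x => ?_) (fun i j x => ?_)
  · rw [fderiv_const_mul ((c1 i).differentiable (by simp) x), _root_.smul_apply, smul_eq_mul,
      fderiv_coord_mul_regInv_rpow hε]
  · linarith [abs_regInv_rpow_le hε hγ x]
  · linarith [hneg _ _ (abs_coord_mul_regInv_rpow_le hε hM1 x i)]
  · linarith [hneg _ _ (abs_fderiv_coord_mul_regInv_rpow_le hε hM1 x i j)]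

theorem sq_add_le {δ : ℝ} (hδ : 0 < δ) (a b : ℝ) :
    (a + b) ^ 2 ≤ (1 + δ) * a ^ 2 + (1 + 1 / δ) * b ^ 2 := by
  have h : (1 + δ) * a ^ 2 + (1 + 1 / δ) * b ^ 2 - (a + b) ^ 2 = (δ * a - b) ^ 2 / δ := by
    field_simp
    ring
  have : 0 ≤ (δ * a - b) ^ 2 / δ := by positivity
  linarith

/-- `L` applied to `(|x|² + ε)^{-γ}`, where `t = (|x|² + ε)^{-1}`. -/
theorem ornsteinUhlenbeck_regInv_rpow {ε : ℝ} (hε : 0 < ε) {γ : ℝ} (hγ : 0 ≤ γ) :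
    ornsteinUhlenbeck (fun x : Space N => ((regInv ε x ^ γ : ℝ) : 𝕜)) =ᵐ[volume] fun x =>
      ((regInv ε x ^ γ * (-(2 * γ * (N - 2 * (γ + 1)) * regInv ε x)
        + (2 * γ * (1 - ε * regInv ε x) - 4 * γ * (γ + 1) * ε * regInv ε x ^ 2)) : ℝ) : 𝕜) := by
  obtain ⟨-, h1, h2⟩ := memH2_regInv_rpow (N := N) (𝕜 := 𝕜) hε hγ
  filter_upwards [ae_all_iff.2 h1, ae_all_iff.2 fun i => h2 i i] with x e1 e2
  simp only [ornsteinUhlenbeck, e1, e2, RCLike.real_smul_eq_coe_mul]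
  simp only [← RCLike.ofReal_mul, ← RCLike.ofReal_sum, ← RCLike.ofReal_sub]
  congr 1
  have h0 := regInv_pos hε x
  have hX : ‖x‖ ^ 2 = ∑ i, x i ^ 2 := EuclideanSpace.real_norm_sq_eq x
  have hXt : ‖x‖ ^ 2 * regInv ε x = 1 - ε * regInv ε x := by
    have : (‖x‖ ^ 2 + ε) * regInv ε x = 1 := mul_inv_cancel₀ (by positivity)
    linarith
  rw [Real.rpow_add_one h0.ne']
  set t := regInv ε x
  set H := t ^ γ
  have e : ∑ i : Fin N, -2 * γ * ((if True then 1 else 0) * (H * t)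
      - 2 * (γ + 1) * (x i * t * (x i * (H * t)))) - ∑ i, x i * (-2 * γ * (x i * (H * t)))
      = -2 * γ * N * (H * t) + 4 * γ * (γ + 1) * (‖x‖ ^ 2 * t) * (H * t)
        + 2 * γ * (‖x‖ ^ 2 * t) * H := by
    have hNs : (N : ℝ) = ∑ i : Fin N, 1 := by simp
    rw [hNs, hX]
    simp only [Finset.mul_sum, Finset.sum_mul, ← Finset.sum_sub_distrib, ← Finset.sum_add_distrib]
    refine Finset.sum_congr rfl fun i _ => ?_
    simp only [if_true]
    ring
  rw [e, hXt]
  ring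

theorem regInv_rpow_sq {ε : ℝ} (hε : 0 < ε) (γ : ℝ) (x : Space N) :
    (regInv ε x ^ γ) ^ 2 = regInv ε x ^ (2 * γ) := by
  rw [← Real.rpow_natCast, ← Real.rpow_mul (regInv_pos hε x).le, mul_comm]
  norm_num

theorem gradSq_regInv_rpow_le {ε : ℝ} (hε : 0 < ε) {γ : ℝ} (hγ : 0 ≤ γ) :
    gradSq (fun x : Space N => ((regInv ε x ^ γ : ℝ) : 𝕜)) ≤ᵐ[volume] fun x =>
      4 * γ ^ 2 * regInv ε x ^ (2 * γ + 1) := by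
  obtain ⟨-, h1, -⟩ := memH2_regInv_rpow (N := N) (𝕜 := 𝕜) hε hγ
  filter_upwards [ae_all_iff.2 h1] with x e1
  have h0 := regInv_pos hε x
  have hX : ‖x‖ ^ 2 = ∑ i, x i ^ 2 := EuclideanSpace.real_norm_sq_eq x
  simp only [gradSq, e1, RCLike.norm_ofReal, sq_abs]
  rw [Real.rpow_add_one h0.ne', Real.rpow_add_one h0.ne', ← regInv_rpow_sq hε]
  have hXt := normSq_mul_regInv_le hε x
  set t := regInv ε x
  set H := t ^ γ
  have e : ∑ i, (-2 * γ * (x i * (H * t))) ^ 2 = (4 * γ ^ 2 * (H ^ 2 * t)) * (‖x‖ ^ 2 * t) := by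
    rw [hX]
    simp only [Finset.mul_sum, Finset.sum_mul]
    refine Finset.sum_congr rfl fun i _ => ?_
    ring
  rw [e]
  exact mul_le_of_le_one_right (by positivity) hXt

theorem norm_sq_ornsteinUhlenbeck_regInv_rpow_le {ε : ℝ} (hε : 0 < ε) {γ δ : ℝ} (hγ : 0 ≤ γ)
    (hδ : 0 < δ) :
    (fun x => ‖ornsteinUhlenbeck (fun x : Space N => ((regInv ε x ^ γ : ℝ) : 𝕜)) x‖ ^ 2)
      ≤ᵐ[volume] fun x =>
        (1 + δ) * (2 * γ * (N - 2 * (γ + 1))) ^ 2 * regInv ε x ^ (2 * γ + 2) +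
        2 * (1 + 1 / δ) * ((4 * γ * (γ + 1)) ^ 2 * ((ε * regInv ε x) * regInv ε x ^ (2 * γ + 2))
          + 4 * γ ^ 2 * regInv ε x ^ (2 * γ)) := by
  filter_upwards [ornsteinUhlenbeck_regInv_rpow (N := N) (𝕜 := 𝕜) hε hγ] with x hx
  have h0 := regInv_pos hε x
  have h1 := mul_regInv_le_one hε x
  have h2 : 0 < ε * regInv ε x := mul_pos hε h0
  rw [hx, RCLike.norm_ofReal, sq_abs, mul_pow,
    show (2 : ℝ) * γ + 2 = 2 * γ + 1 + 1 by ring, Real.rpow_add_one h0.ne',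
    Real.rpow_add_one h0.ne', ← regInv_rpow_sq hε]
  set t := regInv ε x
  set H := t ^ γ
  set b := 4 * γ * (γ + 1)
  set k := 2 * γ * (N - 2 * (γ + 1))
  -- The leading term keeps a factor $1+\delta$ and the error pays $1+1/\delta$. Below,
  -- $0<\varepsilon t\le1$ reduces $(\varepsilon t)^2$ to $\varepsilon t$, the form that is bounded
  -- uniformly.
  have a1 := sq_add_le hδ (-(k * t)) (2 * γ * (1 - ε * t) - b * ε * t ^ 2)
  have a2 : (2 * γ * (1 - ε * t) - b * ε * t ^ 2) ^ 2
      ≤ 2 * (b ^ 2 * ((ε * t) * t ^ 2) + 4 * γ ^ 2) := by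
    have c1 : (1 - ε * t) ^ 2 ≤ 1 := by nlinarith
    have c2 : (ε * t) ^ 2 ≤ ε * t := by nlinarith
    have c3 := mul_le_mul_of_nonneg_left c1 (show 0 ≤ γ ^ 2 by positivity)
    have c4 := mul_le_mul_of_nonneg_left c2 (show 0 ≤ b ^ 2 * t ^ 2 by positivity)
    nlinarith [sq_nonneg (2 * γ * (1 - ε * t) + b * ε * t ^ 2)]
  have a3 := mul_le_mul_of_nonneg_left a2 (show 0 ≤ 1 + 1 / δ by positivity)
  have a4 := mul_le_mul_of_nonneg_left (a1.trans (add_le_add_right a3 _)) (sq_nonneg H)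
  refine a4.trans_eq ?_
  ring

/-- If $c>\kappa^2$, inserting $t^\gamma$ leaves a positive multiple of $\int t^{N/2}\,d\mu$ bounded
uniformly in $\varepsilon$, a contradiction. -/
theorem le_of_forall_rellich (hN : 5 ≤ N) {c C : ℝ}
    (h : ∀ u : Space N → 𝕜, MemH2 u → c * rellichIntegral u ≤
      (∫ x, ‖ornsteinUhlenbeck u x‖ ^ 2 ∂(gaussianMeasure N)) + C * h1NormSq u) (hC : 0 < C) :
    c ≤ (hardyConst N - 1) ^ 2 := by
  by_contra! hc
  have hN' : (5 : ℝ) ≤ N := by exact_mod_cast hN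
  -- This exponent makes $2\gamma+2=N/2$, the borderline of integrability, and
  -- $2\gamma(N-2\gamma-2)=C_0-1$.
  set γ : ℝ := ((N : ℝ) - 4) / 4 with hγd
  have hγ : 0 ≤ γ := by rw [hγd]; linarith
  set κ := 2 * γ * (N - 2 * (γ + 1)) with hκ
  have hκ' : hardyConst N - 1 = κ := by
    rw [hκ, hγd, hardyConst_sub_one]; ring
  rw [hκ'] at hc
  have hκ0 : 0 < κ := by
    rw [← hκ', hardyConst_sub_one]
    have : 0 < ((N : ℝ) - 4) / 2 := by linarith
    positivity
  obtain ⟨B, hB⟩ := exists_uniform_bound hN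
  -- Chosen so that $(1+\delta)\kappa^2$ is the midpoint of $\kappa^2$ and $c$, leaving a gap of
  -- $(c-\kappa^2)/2$.
  set δ := (c - κ ^ 2) / (2 * κ ^ 2) with hδd
  have hδ : 0 < δ := div_pos (by linarith) (by positivity)
  have hδκ : (1 + δ) * κ ^ 2 = (c + κ ^ 2) / 2 := by
    rw [hδd]; field_simp; ring
  set b := 4 * γ * (γ + 1)
  refine not_bounded_integral_regInv_rpow (N := N) (by omega)
    ⟨(2 * (1 + 1 / δ) * (b ^ 2 * B + 4 * γ ^ 2 * B) + C * (B + 4 * γ ^ 2 * B)) /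
      ((c - κ ^ 2) / 2), fun ε hε => ?_⟩
  rw [le_div_iff₀ (by linarith)]
  obtain ⟨B1, B0, B3⟩ := hB ε hε
  have hmem := (memH2_regInv_rpow (N := N) (𝕜 := 𝕜) hε hγ).1
  have hmain := h _ hmem
  set u : Space N → 𝕜 := fun x => ((regInv ε x ^ γ : ℝ) : 𝕜) with hu
  have ac := gaussianMeasure_absolutelyContinuous (N := N)
  have p0 : 2 * γ = (N : ℝ) / 2 - 2 := by rw [hγd]; ring
  have p1 : 2 * γ + 1 = (N : ℝ) / 2 - 1 := by rw [hγd]; ring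
  have p2 : 2 * γ + 2 = (N : ℝ) / 2 := by rw [hγd]; ring
  have i0 := integrable_regInv_rpow (N := N) hε (α := (N : ℝ) / 2 - 2) (by linarith)
  have i1 := integrable_regInv_rpow (N := N) hε (α := (N : ℝ) / 2 - 1) (by linarith)
  have i2 := integrable_regInv_rpow (N := N) hε (α := (N : ℝ) / 2) (by linarith)
  have i3 : Integrable (fun x : Space N => (ε * regInv ε x) * regInv ε x ^ ((N : ℝ) / 2))
      (gaussianMeasure N) :=
    integrable_mul_of_le (C := 1) i2
      (continuous_const.mul (contDiff_regInv hε).continuous) fun x => by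
        rw [abs_of_pos (mul_pos hε (regInv_pos hε x))]
        exact mul_regInv_le_one hε x
  have hR : ∫ x : Space N, regInv ε x ^ ((N : ℝ) / 2) ∂(gaussianMeasure N)
      ≤ rellichIntegral u := by
    have : Nonempty (Fin N) := ⟨⟨0, by omega⟩⟩
    refine integral_mono_ae i2 (hmem.rellich hN).1 ?_
    filter_upwards [ac.ae_le (Measure.ae_ne volume 0)] with x hx
    have h0 := regInv_pos hε x
    have hx0 : 0 < ‖x‖ := norm_pos_iff.2 hx
    simp only [hu, RCLike.norm_ofReal, sq_abs]
    rw [regInv_rpow_sq hε, ← p2, show (2 : ℝ) * γ + 2 = 2 * γ + 1 + 1 by ring,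
      Real.rpow_add_one h0.ne', Real.rpow_add_one h0.ne', le_div_iff₀ (by positivity)]
    have e : regInv ε x ^ (2 * γ) * regInv ε x * regInv ε x * ‖x‖ ^ 4
        = regInv ε x ^ (2 * γ) * (‖x‖ ^ 2 * regInv ε x) ^ 2 := by ring
    rw [e]
    exact mul_le_of_le_one_right (Real.rpow_pos_of_pos h0 _).le
      (pow_le_one₀ (by positivity) (normSq_mul_regInv_le hε x))
  have hL : ∫ x, ‖ornsteinUhlenbeck u x‖ ^ 2 ∂(gaussianMeasure N) ≤
      (1 + δ) * κ ^ 2 * (∫ x : Space N, regInv ε x ^ ((N : ℝ) / 2) ∂(gaussianMeasure N)) +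
        2 * (1 + 1 / δ) * (b ^ 2 * B + 4 * γ ^ 2 * B) := by
    have j : Integrable (fun x : Space N => b ^ 2 * ((ε * regInv ε x) * regInv ε x ^ ((N : ℝ) / 2))
        + 4 * γ ^ 2 * regInv ε x ^ ((N : ℝ) / 2 - 2)) (gaussianMeasure N) :=
      (i3.const_mul (b ^ 2)).add (i0.const_mul (4 * γ ^ 2))
    have l := norm_sq_ornsteinUhlenbeck_regInv_rpow_le (N := N) (𝕜 := 𝕜) hε hγ hδ
    rw [p2, p0, show ((N : ℝ) / 2 - 2) * (N - 2 * (γ + 1)) = κ by rw [hκ, p0]] at l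
    refine (integral_mono_of_nonneg (ae_of_all _ fun x => by positivity)
      ((i2.const_mul _).add (j.const_mul _)) (ac.ae_le l)).trans ?_
    refine (integral_add (i2.const_mul _) (j.const_mul _)).le.trans ?_
    rw [integral_const_mul, integral_const_mul, integral_add (i3.const_mul _) (i0.const_mul _),
      integral_const_mul, integral_const_mul]
    gcongr
  have hH : h1NormSq u ≤ B + 4 * γ ^ 2 * B := by
    refine add_le_add (le_of_eq_of_le ?_ B0) ?_
    · refine integral_congr_ae (ae_of_all _ fun x => ?_)
      simp only [hu, RCLike.norm_ofReal, sq_abs]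
      rw [regInv_rpow_sq hε, p0]
    · have l := gradSq_regInv_rpow_le (N := N) (𝕜 := 𝕜) hε hγ
      rw [p1] at l
      refine (integral_mono_of_nonneg (ae_of_all _ fun x =>
        Finset.sum_nonneg fun i _ => sq_nonneg _) (i1.const_mul _) (ac.ae_le l)).trans ?_
      rw [integral_const_mul]
      gcongr
  -- The sign of $c$ matters because the singular integral is replaced by its lower bound $\int
  -- t^{N/2}\,d\mu$.
  have hc0 : 0 ≤ c := (sq_nonneg κ).trans hc.le
  have f1 := mul_le_mul_of_nonneg_left hR hc0
  have f2 := mul_le_mul_of_nonneg_left hH hC.le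
  rw [hδκ] at hL
  linarith

end Sharpness

end GaussianRellich

end

/-! ### The theorem with its explicit constants. -/

open GaussianRellich in
theorem mainTheorem12 {𝕜 : Type*} [RCLike 𝕜] (N : ℕ) (hN : 5 ≤ N) :
    (∀ u : GaussianRellich.Space N → 𝕜, GaussianRellich.MemH2 u →
      MemLp (GaussianRellich.ornsteinUhlenbeck u) 2 (GaussianRellich.gaussianMeasure N) ∧
      Integrable (fun x => ‖u x‖ ^ 2 / ‖x‖ ^ 4) (GaussianRellich.gaussianMeasure N)) ∧
    (∃ C₁ : ℝ, 0 < C₁ ∧ ∀ u : GaussianRellich.Space N → 𝕜, GaussianRellich.MemH2 u →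
      (GaussianRellich.hardyConst N - 1) ^ 2 * GaussianRellich.rellichIntegral u ≤
        ∫ x, ‖GaussianRellich.ornsteinUhlenbeck u x‖ ^ 2 ∂(GaussianRellich.gaussianMeasure N)
        + 2 * (GaussianRellich.hardyConst N - 1) * C₁ / GaussianRellich.hardyConst N *
            ∫ x, GaussianRellich.gradSq u x ∂(GaussianRellich.gaussianMeasure N)
        + 2 * (GaussianRellich.hardyConst N - 1) * C₁ ^ 2 / GaussianRellich.hardyConst N *
            ∫ x, ‖u x‖ ^ 2 ∂(GaussianRellich.gaussianMeasure N)) ∧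
    (GaussianRellich.hardyConst N - 1) ^ 2 = ((N : ℝ) * ((N : ℝ) - 4) / 4) ^ 2 ∧
    IsGreatest
      {c : ℝ | ∃ C : ℝ, 0 < C ∧ ∀ u : GaussianRellich.Space N → 𝕜, GaussianRellich.MemH2 u →
        c * GaussianRellich.rellichIntegral u ≤
          ∫ x, ‖GaussianRellich.ornsteinUhlenbeck u x‖ ^ 2 ∂(GaussianRellich.gaussianMeasure N)
          + C * GaussianRellich.h1NormSq u}
      ((GaussianRellich.hardyConst N - 1) ^ 2) := by
  have hN' : (5 : ℝ) ≤ N := by exact_mod_cast hN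
  have hC₀ : 0 < hardyConst N := by
    unfold hardyConst
    have : 0 < ((N : ℝ) - 2) / 2 := by linarith
    positivity
  have hb : 0 < ((N : ℝ) - 4) / 2 := by linarith
  have hκ : 0 < hardyConst N - 1 := by
    rw [hardyConst_sub_one]; positivity
  -- The Rellich bound has coefficient $2\kappa(a+1)$ on both lower-order integrals. Taking
  -- $C_1\ge(a+1)C_0$ makes $2\kappa C_1/C_0$ at least that, and the added $1$ ensures $C_1\le
  -- C_1^2$ for the other coefficient.
  refine ⟨fun u hu => ⟨hu.memLp_ornsteinUhlenbeck, (hu.rellich hN).1⟩,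
    ⟨(((N : ℝ) - 4) / 2 + 1) * hardyConst N + 1, by positivity, fun u hu => ?_⟩, ?_,
    ⟨2 * (hardyConst N - 1) * (((N : ℝ) - 4) / 2 + 1), by positivity,
      fun u hu => (hu.rellich hN).2⟩, ?_⟩
  · have h := (hu.rellich hN).2
    set C₁ := (((N : ℝ) - 4) / 2 + 1) * hardyConst N + 1 with hC₁
    have h1 : 1 ≤ C₁ := by
      rw [hC₁]
      have : 0 < (((N : ℝ) - 4) / 2 + 1) * hardyConst N := by positivity
      linarith
    have k1 : 2 * (hardyConst N - 1) * (((N : ℝ) - 4) / 2 + 1)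
        ≤ 2 * (hardyConst N - 1) * C₁ / hardyConst N := by
      rw [le_div_iff₀ hC₀, mul_assoc]
      gcongr
      linarith
    have k2 : 2 * (hardyConst N - 1) * C₁ / hardyConst N
        ≤ 2 * (hardyConst N - 1) * C₁ ^ 2 / hardyConst N := by
      gcongr
      nlinarith
    have g0 : 0 ≤ ∫ x, gradSq u x ∂(gaussianMeasure N) :=
      integral_nonneg fun x => Finset.sum_nonneg fun i _ => sq_nonneg _
    have u0 : 0 ≤ ∫ x, ‖u x‖ ^ 2 ∂(gaussianMeasure N) := integral_nonneg fun x => sq_nonneg _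
    have m1 := mul_le_mul_of_nonneg_right k1 g0
    have m2 := mul_le_mul_of_nonneg_right (k1.trans k2) u0
    rw [h1NormSq, mul_add] at h
    linarith
  · rw [hardyConst_sub_one]; ring
  · rintro c ⟨C, hC, h⟩
    exact le_of_forall_rellich hN h hC
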